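/- Let $k=(k_1,\dots,k_l)$ be positive integers, $n=k_1+\dots+k_l$, and write $z\in\mathbb{C}^n$ as $z=(z_{(1)},\dots,z_{(l)})$ with $z_{(j)}\in\mathbb{C}^{k_j}$. Let $\mathbb{U}^n$ be either $\mathbb{C}^n$ with the Fubini–Study Kähler form $i\partial\bar\partial\log(1+|z|^2)$ (the affine chart $z\mapsto[1,z]$ of $\mathbb{P}^n(\mathbb{C})$) or the unit ball $\mathbb{B}^n$ with the complex hyperbolic Kähler form $-i\partial\bar\partial\log(1-|z|^2)$. Put $V_k=\prod_{j=1}^l(\mathbb{C}^{k_j}\setminus\{0\})$ and $\pi_k:V_k\to\prod_{j=1}^l\mathbb{P}^{k_j-1}(\mathbb{C})$, $\pi_k(z)=([z_{(1)}],\dots,[z_{(l)}])$. Let $T_k\subset\mathbb{T}^n$ be the subgroup of the elements $t$ whose coordinates are constant on each block, acting by $t\cdot z=(t_1z_1,\dots,t_nz_n)$. For $h=(h_1,\dots,h_l)\in\mathbb{N}^l$ let $\mathcal{R}_k(h)$ be the set of functions on $V_k\cap\mathbb{U}^n$ of the form $a(r_1,\dots,r_l)\,\xi^{\alpha}\bar\xi^{\beta}$,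 where $r_j=|z_{(j)}|$, $\xi_{(j)}=z_{(j)}/r_j$, $a$ is a complex-valued function, and $\alpha,\beta\in\mathbb{N}^n$ satisfy $\alpha\cdot\beta=0$, $|\alpha_{(j)}|=|\beta_{(j)}|$ for all $j$, and $\alpha_{j,r}=0$ for $r>h_j$, $\beta_{j,s}=0$ for $s\le h_j$. A Lagrangian frame of a Kähler manifold $N$ is a pair $(\mathcal{O},\mathfrak{F})$ of smooth foliations of $N$ such that the leaves of both are Lagrangian submanifolds, leaves of $\mathcal{O}$ and of $\mathfrak{F}$ are orthogonal wherever they meet, $\mathcal{O}$ is Riemannian (the metric induced on its normal bundle is invariant under the leaf holonomy), and the leaves of $\mathfrak{F}$ are totally geodesic submanifolds of $N$. Then for every $p\in\prod_{j=1}^l\mathbb{P}^{k_j-1}(\mathbb{C})$ the fiber $F_p=\pi_k^{-1}(p)\cap\mathbb{U}^n$ is a complex submanifold of $\mathbb{U}^n$ of complex dimension $l$, hence a Kähler manifold with the structure inherited from $\mathbb{U}^n$, and: 1. The $T_k$-orbits in $F_p$ are the leaves of a Riemannian foliation $\mathcal{O}_p$ of $F_p$ (with leaves of real dimension $l$), and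 every symbol in $\mathcal{R}_k(h)$ is constant on each of its leaves. 2. The orthogonal complement $T\mathcal{O}_p^\perp$ of $T\mathcal{O}_p$ in $TF_p$ is integrable: it is the tangent bundle of a foliation $\mathfrak{F}_p$ of $F_p$, and $\mathfrak{F}_p$ is totally geodesic. 3. The pair $(\mathcal{O}_p,\mathfrak{F}_p)$ is a Lagrangian frame of $F_p$ for the inherited Kähler structure. -/

import Mathlib

open Set Filter Topology
open scoped ContDiff LinearAlgebra.Projectivization

/-! ### Submanifolds and foliations inside a normed space -/

/-- `M` is an embedded `𝕜`-smooth submanifold of dimension `d` of the space `E`: around each of its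
points some local diffeomorphism of `E` straightens `M` to a linear subspace of dimension `d`.
For `𝕜 = ℂ` the charts are biholomorphic, so `M` is a complex submanifold. -/
def IsSubmanifold (𝕜 : Type*) [NontriviallyNormedField 𝕜] {E : Type*} [NormedAddCommGroup E]
    [NormedSpace 𝕜 E] (d : ℕ) (M : Set E) : Prop :=
  ∀ x ∈ M, ∃ (φ : OpenPartialHomeomorph E E) (S : Submodule 𝕜 E),
    x ∈ φ.source ∧ ContDiffOn 𝕜 ∞ φ φ.source ∧ ContDiffOn 𝕜 ∞ φ.symm φ.target ∧
    Module.finrank 𝕜 S = d ∧ ∀ y ∈ φ.source, (y ∈ M ↔ φ y ∈ S)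

section Real

variable {E : Type*} [NormedAddCommGroup E] [NormedSpace ℝ E]

/-- The tangent space at `x` of a submanifold `M` (or of a leaf `M` of a foliation): the set of
velocities at `x` of the smooth curves in `M`. -/
def tangentVectors (M : Set E) (x : E) : Set E :=
  {v | ∃ γ : ℝ → E, ContDiff ℝ ∞ γ ∧ γ 0 = x ∧ HasDerivAt γ v 0 ∧ ∀ᶠ t in 𝓝 (0 : ℝ), γ t ∈ M}

/-- The family of sets `𝓛` is (the set of leaves of) a smooth foliation of the submanifold `N` by
leaves of real dimension `d`: the leaves are path connected, they partition `N`, and around each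
point of `N` there is a chart that straightens `N` to a linear subspace `S` and cuts each leaf in a
union of at most countably many plaques, a plaque being a slice parallel to a fixed
`d`-dimensional subspace `D` of `S`. -/
structure IsFoliation (d : ℕ) (N : Set E) (𝓛 : Set (Set E)) : Prop where
  subset : ∀ L ∈ 𝓛, L ⊆ N
  existsUnique_leaf : ∀ x ∈ N, ∃! L, L ∈ 𝓛 ∧ x ∈ L
  isPathConnected : ∀ L ∈ 𝓛, IsPathConnected L
  chart : ∀ x ∈ N, ∃ (φ : OpenPartialHomeomorph E E) (S D : Submodule ℝ E),
    x ∈ φ.source ∧ ContDiffOn ℝ ∞ φ φ.source ∧ ContDiffOn ℝ ∞ φ.symm φ.target ∧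
    D ≤ S ∧ Module.finrank ℝ D = d ∧
    (∀ y ∈ φ.source, (y ∈ N ↔ φ y ∈ S)) ∧
    ∀ L ∈ 𝓛, ∃ C : Set E, C.Countable ∧
      ∀ y ∈ φ.source, y ∈ N → (y ∈ L ↔ ∃ c ∈ C, φ y - c ∈ D)

/-! ### Riemannian notions

A Riemannian metric on an open subset of `E` is given as `g : E → E → E → ℝ`, where `g x v w` is the
inner product at `x` of the tangent vectors `v` and `w`; submanifolds carry the induced metric. -/

/-- The orthogonal complement of the tangent space of `L` in the tangent space of `N`. -/
def normalVectors (g : E → E → E → ℝ) (N L : Set E) (x : E) : Set E :=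
  {v | v ∈ tangentVectors N x ∧ ∀ w ∈ tangentVectors L x, g x v w = 0}

/-- `Γ` is a smooth family `s ↦ Γ · s` of paths (with parameter `t ∈ [0, 1]`), each of which
runs in one leaf. Such a family realizes the holonomy along the leaf path `Γ · 0`: it slides the
transverse curve `Γ 0 ·` along the leaves to `Γ 1 ·`, so that the (infinitesimal) holonomy maps the
class of `∂ₛ Γ 0 0` modulo the tangent space of the leaf to the class of `∂ₛ Γ 1 0`. -/
def IsLeafwiseFamily (𝓛 : Set (Set E)) (Γ : ℝ → ℝ → E) : Prop :=
  ContDiff ℝ ∞ (fun q : ℝ × ℝ => Γ q.1 q.2) ∧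
    ∀ᶠ s in 𝓝 (0 : ℝ), ∃ L ∈ 𝓛, ∀ t ∈ Icc (0 : ℝ) 1, Γ t s ∈ L

/-- `v` is the component of `u` orthogonal to the tangent space of `L` at `x`. -/
def IsNormalPart (g : E → E → E → ℝ) (L : Set E) (x u v : E) : Prop :=
  u - v ∈ tangentVectors L x ∧ ∀ w ∈ tangentVectors L x, g x v w = 0

/-- The foliation `𝓛` is Riemannian for `g`: the metric induced by `g` on the normal bundle
(identified with the orthogonal complement of the leaves) is invariant under the leaf holonomy. -/
def IsRiemannianFoliation (g : E → E → E → ℝ) (𝓛 : Set (Set E)) : Prop :=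
  ∀ Γ : ℝ → ℝ → E, IsLeafwiseFamily 𝓛 Γ → ∀ L ∈ 𝓛, Γ 0 0 ∈ L → ∀ v w : E,
    IsNormalPart g L (Γ 0 0) (deriv (fun s => Γ 0 s) 0) v →
    IsNormalPart g L (Γ 1 0) (deriv (fun s => Γ 1 s) 0) w →
    g (Γ 0 0) v v = g (Γ 1 0) w w

/-- The inner product with `w` of the covariant acceleration of `γ` for the Levi-Civita connection
of `g`, that is `g(γ'', w) + (∂_{γ'} g)(γ', w) - 1/2 (∂_w g)(γ', γ')`. -/
noncomputable def covariantAcceleration (g : E → E → E → ℝ) (γ : ℝ → E) (t : ℝ) (w : E) : ℝ :=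
  g (γ t) (deriv (deriv γ) t) w
    + fderiv ℝ (fun x => g x (deriv γ t) w) (γ t) (deriv γ t)
    - (1 / 2) * fderiv ℝ (fun x => g x (deriv γ t) (deriv γ t)) (γ t) w

/-- `γ` is on the interval `(a, b)` a geodesic of the submanifold `M` with the metric induced by
`g`: a smooth curve in `M` whose covariant acceleration is orthogonal to `M` (the
Levi-Civita connection of `M` is the tangential part of that of the ambient space). -/
def IsGeodesicOn (g : E → E → E → ℝ) (M : Set E) (a b : ℝ) (γ : ℝ → E) : Prop :=
  ContDiffOn ℝ ∞ γ (Ioo a b) ∧ (∀ t ∈ Ioo a b, γ t ∈ M) ∧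
    ∀ t ∈ Ioo a b, ∀ w ∈ tangentVectors M (γ t), covariantAcceleration g γ t w = 0

/-- `L` is a totally geodesic submanifold of `N`: each geodesic of `L` is a geodesic of `N`. -/
def IsTotallyGeodesic (g : E → E → E → ℝ) (N L : Set E) : Prop :=
  ∀ (a b : ℝ) (γ : ℝ → E), IsGeodesicOn g L a b γ → IsGeodesicOn g N a b γ

end Real

/-! ### Kähler notions -/

section Complex

variable {E : Type*} [NormedAddCommGroup E] [NormedSpace ℂ E]

/-- The fundamental form `ω(v, w) = g(J v, w)`, where `J` is multiplication by `i`. -/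
def fundamentalForm (g : E → E → E → ℝ) (x v w : E) : ℝ :=
  g x (Complex.I • v) w

/-- `g` is a Kähler metric on the open set `U`: a smooth Riemannian metric that is invariant under
the complex structure and has a closed fundamental form. -/
structure IsKahlerMetric (g : E → E → E → ℝ) (U : Set E) : Prop where
  isOpen : IsOpen U
  smooth : ∀ v w : E, ContDiffOn ℝ ∞ (fun x => g x v w) U
  linear : ∀ x ∈ U, ∀ v : E, IsLinearMap ℝ (g x v)
  symm : ∀ x ∈ U, ∀ v w : E, g x v w = g x w v
  pos : ∀ x ∈ U, ∀ v : E, v ≠ 0 → 0 < g x v v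
  hermitian : ∀ x ∈ U, ∀ v w : E, g x (Complex.I • v) (Complex.I • w) = g x v w
  closed : ∀ x ∈ U, ∀ u v w : E,
    fderiv ℝ (fun y => fundamentalForm g y v w) x u
      + fderiv ℝ (fun y => fundamentalForm g y w u) x v
      + fderiv ℝ (fun y => fundamentalForm g y u v) x w = 0

/-- `N` is a complex submanifold of complex dimension `m` of the Kähler manifold `(U, g)`; so it is
itself a Kähler manifold with the inherited structure. -/
structure IsKahlerSubmanifold (g : E → E → E → ℝ) (U : Set E) (m : ℕ) (N : Set E) : Prop where
  kahler : IsKahlerMetric g U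
  subset : N ⊆ U
  submanifold : IsSubmanifold ℂ m N

/-- `L` is Lagrangian in `N`: each tangent space of `L` is its own orthogonal complement with
respect to the fundamental form, inside the tangent space of `N`. -/
def IsLagrangian (g : E → E → E → ℝ) (N L : Set E) : Prop :=
  ∀ x ∈ L, ∀ v ∈ tangentVectors N x,
    (v ∈ tangentVectors L x ↔ ∀ w ∈ tangentVectors L x, fundamentalForm g x v w = 0)

/-- `(𝓞, 𝓕)` is a Lagrangian frame of the Kähler submanifold `N` of complex dimension `m`. -/
structure IsLagrangianFrame (g : E → E → E → ℝ) (m : ℕ) (N : Set E) (𝓞 𝓕 : Set (Set E)) :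
    Prop where
  foliation_fst : IsFoliation m N 𝓞
  foliation_snd : IsFoliation m N 𝓕
  lagrangian_fst : ∀ L ∈ 𝓞, IsLagrangian g N L
  lagrangian_snd : ∀ L ∈ 𝓕, IsLagrangian g N L
  orthogonal : ∀ L₁ ∈ 𝓞, ∀ L₂ ∈ 𝓕, ∀ x ∈ L₁ ∩ L₂,
    ∀ v ∈ tangentVectors L₁ x, ∀ w ∈ tangentVectors L₂ x, g x v w = 0
  riemannian : IsRiemannianFoliation g 𝓞
  totallyGeodesic : ∀ L ∈ 𝓕, IsTotallyGeodesic g N L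

end Complex

/-! ### The model spaces, the torus, the fibers and the symbols -/

/-- The two geometries: `ℂⁿ` inside the complex projective space, and the complex unit ball. -/
inductive Geom where
  | projective
  | hyperbolic

section Model

variable {l : ℕ}

/-- `ℂⁿ` with `n = k₁ + ⋯ + k_l`, whose coordinates are indexed by the pairs `(j, i)` with `i`
in the `j`-th block, which has size `k_j`. -/
abbrev Cn (k : Fin l → ℕ) : Type := EuclideanSpace ℂ (Σ j : Fin l, Fin (k j))

variable {k : Fin l → ℕ}

/-- The domain `𝕌ⁿ`: all of `ℂⁿ`, or the unit ball. -/
def domain (k : Fin l → ℕ) : Geom → Set (Cn k)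
  | .projective => univ
  | .hyperbolic => Metric.ball 0 1

/-- The coefficients of the Kähler forms `i ∂∂̄ log (1 + |z|²)` (Fubini-Study, in the affine
chart `z ↦ [1, z]`) and `-i ∂∂̄ log (1 - |z|²)` (complex hyperbolic), as a Hermitian form in `u`
and `v`. Note that `inner ℂ v u = ∑ u_a * conj v_a`. -/
noncomputable def hermitianForm : Geom → Cn k → Cn k → Cn k → ℂ
  | .projective, z, u, v =>
      ((1 + ‖z‖ ^ 2) * inner ℂ v u - inner ℂ z u * inner ℂ v z) / (1 + ‖z‖ ^ 2) ^ 2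
  | .hyperbolic, z, u, v =>
      ((1 - ‖z‖ ^ 2) * inner ℂ v u + inner ℂ z u * inner ℂ v z) / (1 - ‖z‖ ^ 2) ^ 2

/-- The Kähler metric on `𝕌ⁿ` (the Kähler form `i ∑ h_{ab} dz_a ∧ dz̄_b` corresponds to
the Riemannian metric `2 Re h`). -/
noncomputable def kahlerMetric (X : Geom) (z u v : Cn k) : ℝ :=
  2 * (hermitianForm X z u v).re

/-- The block `z_(j)`. -/
def block (z : Cn k) (j : Fin l) : EuclideanSpace ℂ (Fin (k j)) :=
  WithLp.toLp 2 fun i => z ⟨j, i⟩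

/-- `V_k`, the product of the `ℂ^{k_j} \ {0}`. -/
def Vk (k : Fin l → ℕ) : Set (Cn k) := {z | ∀ j, block z j ≠ 0}

/-- The map `π_k` on `V_k`, `z ↦ ([z_(1)], …, [z_(l)])`. -/
noncomputable def piK (z : Vk k) (j : Fin l) : ℙ ℂ (EuclideanSpace ℂ (Fin (k j))) :=
  Projectivization.mk ℂ (block z.1 j) (z.2 j)

/-- The fiber `F_p` of the restriction of `π_k` to `V_k ∩ 𝕌ⁿ`. -/
def fiber (X : Geom) (p : ∀ j, ℙ ℂ (EuclideanSpace ℂ (Fin (k j)))) : Set (Cn k) :=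
  {z | z ∈ domain k X ∧ ∃ hz : z ∈ Vk k, piK ⟨z, hz⟩ = p}

/-- The action of the torus `𝕋ⁿ` on `ℂⁿ`. -/
noncomputable def torusAct (t : (Σ j : Fin l, Fin (k j)) → Circle) (z : Cn k) : Cn k :=
  WithLp.toLp 2 fun a => (t a : ℂ) * z a

/-- The subgroup `T_k` of `𝕋ⁿ`: the elements that are constant on each block. -/
def Tk (k : Fin l → ℕ) : Subgroup ((Σ j : Fin l, Fin (k j)) → Circle) where
  carrier := {t | ∃ s : Fin l → Circle, ∀ a, t a = s a.1}
  mul_mem' := by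
    rintro _ _ ⟨s, hs⟩ ⟨s', hs'⟩
    exact ⟨s * s', fun a => by simp [hs, hs']⟩
  one_mem' := ⟨1, fun _ => rfl⟩
  inv_mem' := by
    rintro _ ⟨s, hs⟩
    exact ⟨s⁻¹, fun a => by simp [hs]⟩

/-- The `T_k`-orbit of `z`. -/
def orbitTk (z : Cn k) : Set (Cn k) := {w | ∃ t ∈ Tk k, w = torusAct t z}

/-- The set of `T_k`-orbits in the fiber `F_p`. -/
def orbitLeaves (X : Geom) (p : ∀ j, ℙ ℂ (EuclideanSpace ℂ (Fin (k j)))) : Set (Set (Cn k)) :=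
  orbitTk '' fiber X p

/-- The space of symbols `𝓡_k(h)`: the functions on `V_k ∩ 𝕌ⁿ` of the form
`a(r₁, …, r_l) ξ^p ξ̄^q`, where `r_j = |z_(j)|` and `ξ_(j) = z_(j) / r_j`, the multi-indices `p`
and `q` are orthogonal with `|p_(j)| = |q_(j)|` for all `j`, in the `j`-th block `p` is
supported on the first `h_j` positions, and `q` is supported on the others. -/
def symbols (X : Geom) (k h : Fin l → ℕ) : Set (↥(Vk k ∩ domain k X) → ℂ) :=
  {f | ∃ (a : (Fin l → ℝ) → ℂ) (p q : (Σ j : Fin l, Fin (k j)) → ℕ),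
    (∑ b, p b * q b = 0) ∧
    (∀ j, ∑ i, p ⟨j, i⟩ = ∑ i, q ⟨j, i⟩) ∧
    (∀ j (i : Fin (k j)), h j ≤ i.1 → p ⟨j, i⟩ = 0) ∧
    (∀ j (i : Fin (k j)), i.1 < h j → q ⟨j, i⟩ = 0) ∧
    ∀ z, f z = a (fun j => ‖block z.1 j‖) *
      ((∏ b, (z.1 b / ‖block z.1 b.1‖) ^ p b) *
        ∏ b, (starRingEnd ℂ) (z.1 b / ‖block z.1 b.1‖) ^ q b)}

end Model

/-! Choose a unit vector `e j` on each line `p j`. Then `blockEmb e` is a linear isometric embedding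
of `ℂ^l`, and the fiber is the part of the image of `(ℂ \ {0})^l` that lies in the domain
(`mem_fiber_iff`). In the coordinates `w`, the torus orbits fix all moduli `‖w j‖`, while the
candidate orthogonal leaves fix all arguments. Holomorphic coordinates `log (w j / c j)` turn these
two families into translates of `iℝ^l` and `ℝ^l`, so both are foliations.

The geometry rests on one fact: on `realSpan e w`, the vectors `(ρ j * w j)` with real `ρ`, all
Hermitian products are real, because `conj (w j) * w j` is (`inner_im_of_mem_realSpan`). Both
metrics are built from such products, so `R = realSpan e w` is orthogonal to `iR` at `w`, and the
tangent space of the fiber is `R ⊕ iR`. The radial leaf has tangent space `R` and the orbit has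
`iR`; hence the two are orthogonal complements of each other and both are Lagrangian
(`forall_kahlerMetric_I_smul_eq_zero_iff`).

The orbits form a Riemannian foliation because the moduli are constant on them and determine the
normal part of a velocity, whose length also depends on the moduli only. The radial leaves are
totally geodesic because complex conjugation relative to `R` is an isometry of the fiber fixing `R`;
only its infinitesimal form is needed, the evenness of the metric in the directions `iR`. -/

/-! ### The model metrics -/

section Metric

variable {l : ℕ} {k : Fin l → ℕ}

/-- The sign of the holomorphic sectional curvature. -/
def Geom.sign : Geom → ℝ
  | .projective => 1
  | .hyperbolic => -1

/-- The conformal denominator `1 ± |z|²`. -/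
noncomputable def Geom.denom (X : Geom) (z : Cn k) : ℝ := 1 + X.sign * (inner ℂ z z).re

theorem inner_self_re_eq (z : Cn k) : (inner ℂ z z).re = ‖z‖ ^ 2 := by
  rw [inner_self_eq_norm_sq_to_K]
  norm_cast

theorem Geom.denom_eq (X : Geom) (z : Cn k) : X.denom z = 1 + X.sign * ‖z‖ ^ 2 := by
  rw [Geom.denom, inner_self_re_eq]

theorem isOpen_domain (X : Geom) : IsOpen (domain k X) := by
  cases X
  · exact isOpen_univ
  · exact Metric.isOpen_ball

theorem convex_domain (X : Geom) : Convex ℝ (domain k X) := by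
  cases X
  · exact convex_univ
  · exact convex_ball 0 1

theorem mem_domain_of_norm_eq {X : Geom} {z w : Cn k} (h : ‖w‖ = ‖z‖) (hz : z ∈ domain k X) :
    w ∈ domain k X := by
  cases X
  · exact mem_univ _
  · simpa [domain, h] using hz

theorem Geom.denom_pos {X : Geom} {z : Cn k} (hz : z ∈ domain k X) : 0 < X.denom z := by
  rw [Geom.denom_eq]
  cases X
  · simp only [Geom.sign]
    positivity
  · simp only [Geom.sign]
    have h : ‖z‖ < 1 := by simpa [domain] using hz
    nlinarith [norm_nonneg z]

/-- The sign treats both geometries at once, and splitting into real and imaginary parts reduces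
later metric identities to real algebra. -/
theorem kahlerMetric_eq (X : Geom) (z u v : Cn k) :
    kahlerMetric X z u v = 2 * ((X.denom z * (inner ℂ v u).re -
      X.sign * ((inner ℂ z u).re * (inner ℂ v z).re - (inner ℂ z u).im * (inner ℂ v z).im)) /
        X.denom z ^ 2) := by
  rw [Geom.denom_eq]
  cases X
  · have h : hermitianForm .projective z u v =
        ((1 + ‖z‖ ^ 2 : ℝ) * inner ℂ v u - inner ℂ z u * inner ℂ v z) /
          (((1 + ‖z‖ ^ 2) ^ 2 : ℝ) : ℂ) := by
      simp [hermitianForm]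
    rw [kahlerMetric, h, Complex.div_ofReal_re, Complex.sub_re, Complex.re_ofReal_mul,
      Complex.mul_re]
    simp [Geom.sign]
  · have h : hermitianForm .hyperbolic z u v =
        ((1 - ‖z‖ ^ 2 : ℝ) * inner ℂ v u + inner ℂ z u * inner ℂ v z) /
          (((1 - ‖z‖ ^ 2) ^ 2 : ℝ) : ℂ) := by
      simp [hermitianForm]
    rw [kahlerMetric, h, Complex.div_ofReal_re, Complex.add_re, Complex.re_ofReal_mul,
      Complex.mul_re]
    simp [Geom.sign, sub_eq_add_neg]

theorem contDiff_denom (X : Geom) : ContDiff ℝ ∞ (fun z : Cn k => X.denom z) := by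
  have h : ContDiff ℝ ∞ (fun z : Cn k => inner ℂ z z) := contDiff_id.inner ℂ contDiff_id
  exact contDiff_const.add (contDiff_const.mul (Complex.reCLM.contDiff.comp h))

theorem contDiffOn_kahlerMetric (X : Geom) (u v : Cn k) :
    ContDiffOn ℝ ∞ (fun z => kahlerMetric X z u v) (domain k X) := by
  have h₁ : ContDiff ℝ ∞ (fun z : Cn k => inner ℂ z u) := contDiff_id.inner ℂ contDiff_const
  have h₂ : ContDiff ℝ ∞ (fun z : Cn k => inner ℂ v z) := contDiff_const.inner ℂ contDiff_id
  have re₁ := Complex.reCLM.contDiff.comp h₁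
  have re₂ := Complex.reCLM.contDiff.comp h₂
  have im₁ := Complex.imCLM.contDiff.comp h₁
  have im₂ := Complex.imCLM.contDiff.comp h₂
  have hd := contDiff_denom (k := k) X
  simp only [kahlerMetric_eq]
  exact contDiffOn_const.mul (((hd.mul contDiff_const).sub
    (contDiff_const.mul ((re₁.mul re₂).sub (im₁.mul im₂)))).contDiffOn.div (hd.pow 2).contDiffOn
      fun z hz => (pow_pos (Geom.denom_pos hz) 2).ne')

theorem differentiableAt_kahlerMetric {X : Geom} {z : Cn k} (hz : z ∈ domain k X) (u v : Cn k) :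
    DifferentiableAt ℝ (fun z => kahlerMetric X z u v) z :=
  ((contDiffOn_kahlerMetric X u v).contDiffAt ((isOpen_domain X).mem_nhds hz)).differentiableAt
    (by simp)

theorem kahlerMetric_add_right (X : Geom) (z u v w : Cn k) :
    kahlerMetric X z u (v + w) = kahlerMetric X z u v + kahlerMetric X z u w := by
  simp only [kahlerMetric_eq, inner_add_left, Complex.add_re, Complex.add_im]
  ring

theorem kahlerMetric_smul_right (X : Geom) (z u v : Cn k) (c : ℝ) :
    kahlerMetric X z u (c • v) = c * kahlerMetric X z u v := by
  have h : c • v = (c : ℂ) • v := (Complex.coe_smul c v).symm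
  simp only [kahlerMetric_eq, h, inner_smul_left, Complex.conj_ofReal, Complex.re_ofReal_mul,
    Complex.im_ofReal_mul]
  ring

theorem kahlerMetric_symm (X : Geom) (z u v : Cn k) :
    kahlerMetric X z u v = kahlerMetric X z v u := by
  simp only [kahlerMetric_eq]
  rw [← inner_conj_symm u v, ← inner_conj_symm z v, ← inner_conj_symm u z]
  simp only [Complex.conj_re, Complex.conj_im]
  ring

theorem kahlerMetric_add_left (X : Geom) (z u v w : Cn k) :
    kahlerMetric X z (u + v) w = kahlerMetric X z u w + kahlerMetric X z v w := by
  rw [kahlerMetric_symm, kahlerMetric_add_right, kahlerMetric_symm X z w u,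
    kahlerMetric_symm X z w v]

theorem kahlerMetric_I_smul (X : Geom) (z u v : Cn k) :
    kahlerMetric X z (Complex.I • u) (Complex.I • v) = kahlerMetric X z u v := by
  simp only [kahlerMetric_eq, inner_smul_left, inner_smul_right, Complex.conj_I, Complex.mul_re,
    Complex.mul_im, Complex.neg_re, Complex.neg_im, Complex.I_re, Complex.I_im]
  ring

theorem kahlerMetric_pos {X : Geom} {z : Cn k} (hz : z ∈ domain k X) {v : Cn k} (hv : v ≠ 0) :
    0 < kahlerMetric X z v v := by
  have hD := Geom.denom_pos hz
  have hv' : 0 < ‖v‖ := norm_pos_iff.2 hv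
  -- Cauchy–Schwarz is what the projective case needs; in the hyperbolic case the second term
  -- already has the good sign.
  have hcs : (inner ℂ z v).re ^ 2 + (inner ℂ z v).im ^ 2 ≤ ‖z‖ ^ 2 * ‖v‖ ^ 2 := by
    have h := norm_inner_le_norm (𝕜 := ℂ) z v
    have h2 : ‖(inner ℂ z v : ℂ)‖ ^ 2 ≤ (‖z‖ * ‖v‖) ^ 2 := by gcongr
    rw [Complex.sq_norm, Complex.normSq_apply] at h2
    linarith
  rw [kahlerMetric_eq, ← inner_conj_symm v z, inner_self_re_eq]
  simp only [Complex.conj_re, Complex.conj_im]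
  refine mul_pos two_pos (div_pos ?_ (pow_pos hD 2))
  rw [Geom.denom_eq] at hD ⊢
  cases X
  · simp only [Geom.sign] at *
    nlinarith [pow_pos hv' 2]
  · simp only [Geom.sign] at *
    nlinarith [mul_pos hD (pow_pos hv' 2), sq_nonneg (inner ℂ z v).re,
      sq_nonneg (inner ℂ z v).im]

theorem hasDerivAt_line (x u : Cn k) : HasDerivAt (fun t : ℝ => x + t • u) u 0 := by
  simpa using ((hasDerivAt_id (0 : ℝ)).smul_const u).const_add x

theorem hasDerivAt_kahlerMetric_line {X : Geom} {x : Cn k} (hx : x ∈ domain k X)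
    (u v w : Cn k) :
    HasDerivAt (fun t : ℝ => kahlerMetric X (x + t • u) v w)
      (fderiv ℝ (fun y => kahlerMetric X y v w) x u) 0 := by
  have h := (differentiableAt_kahlerMetric hx v w).hasFDerivAt
  have h' : HasFDerivAt (fun y => kahlerMetric X y v w)
      (fderiv ℝ (fun y => kahlerMetric X y v w) x) (x + (0 : ℝ) • u) := by simpa using h
  exact h'.comp_hasDerivAt (0 : ℝ) (hasDerivAt_line x u)

/-- Quotient rule along the line `x + t • u`; the explicit value makes closedness of the fundamental
form an algebraic identity. -/
theorem fderiv_kahlerMetric {X : Geom} {x : Cn k} (hx : x ∈ domain k X) (u v w : Cn k) :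
    fderiv ℝ (fun y => kahlerMetric X y v w) x u =
      2 * ((2 * X.sign * (inner ℂ x u).re * (inner ℂ w v).re -
        X.sign * ((inner ℂ u v).re * (inner ℂ w x).re + (inner ℂ x v).re * (inner ℂ w u).re -
          (inner ℂ u v).im * (inner ℂ w x).im - (inner ℂ x v).im * (inner ℂ w u).im)) /
            X.denom x ^ 2 -
        (X.denom x * (inner ℂ w v).re - X.sign * ((inner ℂ x v).re * (inner ℂ w x).re -
          (inner ℂ x v).im * (inner ℂ w x).im)) *
            (4 * X.sign * (inner ℂ x u).re) / X.denom x ^ 3) := by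
  refine (hasDerivAt_kahlerMetric_line hx u v w).unique ?_
  have hl := hasDerivAt_line x u
  have h₁ : HasDerivAt (fun t : ℝ => inner ℂ (x + t • u) v) (inner ℂ u v) 0 :=
    (hl.inner ℂ (hasDerivAt_const (0 : ℝ) v)).congr_deriv (by simp)
  have h₂ : HasDerivAt (fun t : ℝ => inner ℂ w (x + t • u)) (inner ℂ w u) 0 :=
    ((hasDerivAt_const (0 : ℝ) w).inner ℂ hl).congr_deriv (by simp)
  have h₃ : HasDerivAt (fun t : ℝ => inner ℂ (x + t • u) (x + t • u))
      (inner ℂ x u + inner ℂ u x) 0 :=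
    (hl.inner ℂ hl).congr_deriv (by simp)
  have re₁ := Complex.reCLM.hasFDerivAt.comp_hasDerivAt (0 : ℝ) h₁
  have re₂ := Complex.reCLM.hasFDerivAt.comp_hasDerivAt (0 : ℝ) h₂
  have re₃ := Complex.reCLM.hasFDerivAt.comp_hasDerivAt (0 : ℝ) h₃
  have im₁ := Complex.imCLM.hasFDerivAt.comp_hasDerivAt (0 : ℝ) h₁
  have im₂ := Complex.imCLM.hasFDerivAt.comp_hasDerivAt (0 : ℝ) h₂
  have hD : HasDerivAt (fun t : ℝ => X.denom (x + t • u)) (2 * X.sign * (inner ℂ x u).re) 0 := by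
    refine ((re₃.const_mul X.sign).const_add 1).congr_deriv ?_
    have hre : (inner ℂ u x).re = (inner ℂ x u).re := by
      rw [← inner_conj_symm]
      exact Complex.conj_re _
    simp [hre]
    ring
  have hne : X.denom (x + (0 : ℝ) • u) ^ 2 ≠ 0 := by
    simpa using (Geom.denom_pos hx).ne'
  have hne' := (Geom.denom_pos hx).ne'
  simp only [kahlerMetric_eq]
  refine ((((hD.mul_const _).sub (((re₁.mul re₂).sub (im₁.mul im₂)).const_mul X.sign)).div
    (hD.pow 2) hne).const_mul 2).congr_deriv ?_
  simp
  field_simp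
  ring

theorem isKahlerMetric_kahlerMetric (X : Geom) : IsKahlerMetric (kahlerMetric X) (domain k X) where
  isOpen := isOpen_domain X
  smooth := contDiffOn_kahlerMetric X
  linear x _ v := ⟨kahlerMetric_add_right X x v, fun c w => kahlerMetric_smul_right X x v w c⟩
  symm x _ := kahlerMetric_symm X x
  pos x hx v := kahlerMetric_pos hx
  hermitian x _ := kahlerMetric_I_smul X x
  closed x hx u v w := by
    have key : ∀ u v w : Cn k, fderiv ℝ (fun y => fundamentalForm (kahlerMetric X) y v w) x u =
        fderiv ℝ (fun y => kahlerMetric X y (Complex.I • v) w) x u := fun _ _ _ => rfl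
    refine (congrArg₂ _ (congrArg₂ _ ((key u v w).trans (fderiv_kahlerMetric hx _ _ _))
      ((key v w u).trans (fderiv_kahlerMetric hx _ _ _)))
      ((key w u v).trans (fderiv_kahlerMetric hx _ _ _))).trans ?_
    have hne := (Geom.denom_pos hx).ne'
    rw [← inner_conj_symm w u, ← inner_conj_symm v w, ← inner_conj_symm u v,
      ← inner_conj_symm w x, ← inner_conj_symm v x, ← inner_conj_symm u x]
    simp only [inner_smul_right, Complex.mul_re, Complex.mul_im, Complex.I_re, Complex.I_im,
      Complex.conj_re, Complex.conj_im]
    -- A second pass: some products in the wrong order appear only once the factor `I` has been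
    -- pulled out.
    rw [← inner_conj_symm w u, ← inner_conj_symm v w, ← inner_conj_symm u v]
    simp only [Complex.conj_re, Complex.conj_im]
    field_simp
    ring

end Metric

/-! ### Linear coordinates on the fibers -/

/-- The difference quotients lie in `P`, which is closed. This bounds the tangent spaces of sets
lying in a linear subspace. -/
theorem HasDerivAt.mem_of_eventually_mem {E : Type*} [NormedAddCommGroup E] [NormedSpace ℝ E]
    [FiniteDimensional ℝ E] (P : Submodule ℝ E) {γ : ℝ → E} {v : E} {t : ℝ}
    (hγ : HasDerivAt γ v t) (hP : ∀ᶠ s in 𝓝 t, γ s ∈ P) : v ∈ P := by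
  refine P.closed_of_finiteDimensional.mem_of_tendsto (hasDerivAt_iff_tendsto_slope_zero.1 hγ) ?_
  have h : Tendsto (fun s => t + s) (𝓝[≠] 0) (𝓝 t) := by
    have : Tendsto (fun s => t + s) (𝓝 0) (𝓝 (t + 0)) := (continuous_const_add t).tendsto 0
    rw [add_zero] at this
    exact this.mono_left nhdsWithin_le_nhds
  filter_upwards [h.eventually hP] with s hs
  exact P.smul_mem _ (P.sub_mem hs hP.self_of_nhds)

section Coordinates

variable {l : ℕ} {k : Fin l → ℕ}

/-- The embedding `w ↦ (w₁ e₁, …, w_l e_l)`. -/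
noncomputable def blockEmb (e : ∀ j, EuclideanSpace ℂ (Fin (k j))) : (Fin l → ℂ) →L[ℂ] Cn k :=
  LinearMap.toContinuousLinearMap
    { toFun := fun w => WithLp.toLp 2 fun a => w a.1 * e a.1 a.2
      map_add' := fun w w' => by ext a; simp [add_mul]
      map_smul' := fun c w => by ext a; simp [mul_assoc] }

/-- The coordinates `z ↦ (⟨e₁, z₍₁₎⟩, …, ⟨e_l, z₍ₗ₎⟩)`. -/
noncomputable def blockCoord (e : ∀ j, EuclideanSpace ℂ (Fin (k j))) : Cn k →L[ℂ] (Fin l → ℂ) :=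
  LinearMap.toContinuousLinearMap
    { toFun := fun z j => inner ℂ (e j) (block z j)
      map_add' := fun z z' => by
        ext j
        simp only [Pi.add_apply, ← inner_add_right]
        rfl
      map_smul' := fun c z => by
        ext j
        simp only [Pi.smul_apply, smul_eq_mul, RingHom.id_apply, ← inner_smul_right]
        rfl }

variable (e : ∀ j, EuclideanSpace ℂ (Fin (k j)))

@[simp] theorem blockEmb_apply (w : Fin l → ℂ) (a : Σ j : Fin l, Fin (k j)) :
    blockEmb e w a = w a.1 * e a.1 a.2 := rfl

theorem block_blockEmb (w : Fin l → ℂ) (j : Fin l) : block (blockEmb e w) j = w j • e j := by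
  ext i
  rfl

theorem blockCoord_apply (z : Cn k) (j : Fin l) :
    blockCoord e z j = inner ℂ (e j) (block z j) := rfl

theorem inner_eq_sum_block (z w : Cn k) : inner ℂ z w = ∑ j, inner ℂ (block z j) (block w j) := by
  simp only [PiLp.inner_apply, block, Fintype.sum_sigma]

/-- The vectors `(ρ₁ w₁ e₁, …, ρ_l w_l e_l)` with real `ρ_j`. -/
noncomputable def realSpan (w : Fin l → ℂ) : Submodule ℝ (Cn k) :=
  LinearMap.range
    ({ toFun := fun ρ => blockEmb e fun j => (ρ j : ℂ) * w j
       map_add' := fun ρ ρ' => by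
        rw [← map_add]
        congr 1
        ext j
        simp [add_mul]
       map_smul' := fun c ρ => by
        rw [RingHom.id_apply, ← Complex.coe_smul, ← map_smul]
        congr 1
        ext j
        simp [mul_assoc] } : (Fin l → ℝ) →ₗ[ℝ] Cn k)

theorem mem_realSpan {w : Fin l → ℂ} {v : Cn k} :
    v ∈ realSpan e w ↔ ∃ ρ : Fin l → ℝ, v = blockEmb e fun j => (ρ j : ℂ) * w j := by
  rw [realSpan, LinearMap.mem_range]
  exact exists_congr fun ρ => eq_comm

theorem blockEmb_mem_realSpan (w : Fin l → ℂ) : blockEmb e w ∈ realSpan e w :=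
  (mem_realSpan e).2 ⟨fun _ => 1, by simp⟩

variable {e}

theorem projectivization_mk_eq_iff {j : Fin l} {x y : EuclideanSpace ℂ (Fin (k j))} (hx : x ≠ 0)
    (hy : y ≠ 0) : Projectivization.mk ℂ x hx = Projectivization.mk ℂ y hy ↔
      ∃ c : ℂ, c ≠ 0 ∧ x = c • y := by
  rw [Projectivization.mk_eq_mk_iff]
  constructor
  · rintro ⟨c, hc⟩
    exact ⟨c, c.ne_zero, hc.symm⟩
  · rintro ⟨c, hc, h⟩
    exact ⟨Units.mk0 c hc, h.symm⟩

theorem mem_fiber_iff {X : Geom} {p : ∀ j, ℙ ℂ (EuclideanSpace ℂ (Fin (k j)))}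
    (he : ∀ j, e j ≠ 0) (hp : ∀ j, p j = Projectivization.mk ℂ (e j) (he j)) {z : Cn k} :
    z ∈ fiber X p ↔ z ∈ domain k X ∧ ∃ w : Fin l → ℂ, (∀ j, w j ≠ 0) ∧ z = blockEmb e w := by
  refine and_congr_right fun _ => ⟨?_, ?_⟩
  · rintro ⟨hz, h⟩
    have h' : ∀ j, ∃ c : ℂ, c ≠ 0 ∧ block z j = c • e j := fun j => by
      rw [← projectivization_mk_eq_iff (hz j) (he j), ← hp j, ← h]
      rfl
    choose w hw hzw using h'
    refine ⟨w, hw, ?_⟩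
    ext a
    exact congrArg (fun x : EuclideanSpace ℂ (Fin (k a.1)) => x a.2) (hzw a.1)
  · rintro ⟨w, hw, rfl⟩
    have hV : blockEmb e w ∈ Vk k := fun j => by
      rw [block_blockEmb]
      exact smul_ne_zero (hw j) (he j)
    refine ⟨hV, funext fun j => ?_⟩
    rw [hp j]
    exact (projectivization_mk_eq_iff (hV j) (he j)).2 ⟨w j, hw j, block_blockEmb e w j⟩


theorem inner_blockEmb (he : ∀ j, ‖e j‖ = 1) (w w' : Fin l → ℂ) :
    inner ℂ (blockEmb e w) (blockEmb e w') = ∑ j, (starRingEnd ℂ) (w j) * w' j := by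
  rw [inner_eq_sum_block]
  refine Finset.sum_congr rfl fun j _ => ?_
  rw [block_blockEmb, block_blockEmb, inner_smul_left, inner_smul_right,
    inner_self_eq_norm_sq_to_K, he j]
  simp

theorem blockCoord_blockEmb (he : ∀ j, ‖e j‖ = 1) (w : Fin l → ℂ) :
    blockCoord e (blockEmb e w) = w := by
  ext j
  rw [blockCoord_apply, block_blockEmb, inner_smul_right, inner_self_eq_norm_sq_to_K, he j]
  simp

theorem blockEmb_injective (he : ∀ j, ‖e j‖ = 1) : Function.Injective (blockEmb e) :=
  Function.LeftInverse.injective (blockCoord_blockEmb he)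

theorem norm_blockEmb_eq (he : ∀ j, ‖e j‖ = 1) {w w' : Fin l → ℂ} (h : ∀ j, ‖w' j‖ = ‖w j‖) :
    ‖blockEmb e w'‖ = ‖blockEmb e w‖ := by
  have key : ‖blockEmb e w'‖ ^ 2 = ‖blockEmb e w‖ ^ 2 := by
    rw [← inner_self_re_eq, ← inner_self_re_eq, inner_blockEmb he, inner_blockEmb he]
    simp only [Complex.conj_mul', h]
  exact (pow_left_inj₀ (norm_nonneg _) (norm_nonneg _) two_ne_zero).1 key

theorem finrank_range_blockEmb (he : ∀ j, ‖e j‖ = 1) :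
    Module.finrank ℂ (LinearMap.range (blockEmb e).toLinearMap) = l := by
  rw [LinearMap.finrank_range_of_inj (blockEmb_injective he)]
  simp

theorem finrank_realSpan (he : ∀ j, ‖e j‖ = 1) {w : Fin l → ℂ} (hw : ∀ j, w j ≠ 0) :
    Module.finrank ℝ (realSpan e w) = l := by
  rw [realSpan, LinearMap.finrank_range_of_inj]
  · simp
  · intro ρ ρ' h
    have h' := blockEmb_injective he (a₁ := fun j => (ρ j : ℂ) * w j)
      (a₂ := fun j => (ρ' j : ℂ) * w j) h
    ext j
    simpa [hw j] using congrFun h' j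

/-- Each summand is `ρ j * σ j * ‖w j‖ ^ 2`: the span is totally real. -/
theorem inner_im_of_mem_realSpan (he : ∀ j, ‖e j‖ = 1) {w : Fin l → ℂ} {u v : Cn k}
    (hu : u ∈ realSpan e w) (hv : v ∈ realSpan e w) : (inner ℂ u v).im = 0 := by
  obtain ⟨ρ, rfl⟩ := (mem_realSpan e).1 hu
  obtain ⟨σ, rfl⟩ := (mem_realSpan e).1 hv
  rw [inner_blockEmb he, Complex.im_sum]
  refine Finset.sum_eq_zero fun j _ => ?_
  simp only [map_mul, Complex.conj_ofReal, Complex.mul_im, Complex.mul_re, Complex.conj_re,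
    Complex.conj_im, Complex.ofReal_re, Complex.ofReal_im]
  ring

/-- Split each quotient `b j / w j` into real and imaginary parts. -/
theorem exists_add_I_smul {w : Fin l → ℂ} (hw : ∀ j, w j ≠ 0) (b : Fin l → ℂ) :
    ∃ u ∈ realSpan e w, ∃ v ∈ realSpan e w, blockEmb e b = u + Complex.I • v := by
  refine ⟨_, (mem_realSpan e).2 ⟨fun j => (b j / w j).re, rfl⟩, _,
    (mem_realSpan e).2 ⟨fun j => (b j / w j).im, rfl⟩, ?_⟩
  rw [← map_smul, ← map_add]
  congr 1
  ext j
  have h : b j = (((b j / w j).re : ℂ) + (b j / w j).im * Complex.I) * w j := by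
    rw [Complex.re_add_im, div_mul_cancel₀ _ (hw j)]
  refine h.trans ?_
  simp only [Pi.add_apply, Pi.smul_apply, smul_eq_mul]
  ring

theorem realSpan_le_range (w : Fin l → ℂ) {v : Cn k} (hv : v ∈ realSpan e w) :
    v ∈ LinearMap.range (blockEmb e).toLinearMap := by
  obtain ⟨ρ, rfl⟩ := (mem_realSpan e).1 hv
  exact ⟨_, rfl⟩

theorem kahlerMetric_I_smul_right_eq_zero (X : Geom) {x u v : Cn k} (hxu : (inner ℂ x u).im = 0)
    (hvx : (inner ℂ v x).im = 0) (hvu : (inner ℂ v u).im = 0) :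
    kahlerMetric X x u (Complex.I • v) = 0 := by
  rw [kahlerMetric_eq]
  simp [hxu, hvx, hvu]

/-- In the fiber, the normal space of the torus orbit is the real span of the point. -/
theorem forall_kahlerMetric_I_smul_eq_zero_iff (he : ∀ j, ‖e j‖ = 1) {X : Geom}
    {w : Fin l → ℂ} (hw : ∀ j, w j ≠ 0) (hX : blockEmb e w ∈ domain k X) {v : Cn k}
    (hv : v ∈ LinearMap.range (blockEmb e).toLinearMap) :
    (∀ u ∈ realSpan e w, kahlerMetric X (blockEmb e w) v (Complex.I • u) = 0) ↔
      v ∈ realSpan e w := by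
  have hx := blockEmb_mem_realSpan e w
  constructor
  · intro h
    obtain ⟨b, rfl⟩ := hv
    obtain ⟨a, ha, c, hc, hac⟩ := exists_add_I_smul (e := e) hw b
    have hc0 : c = 0 := by
      by_contra hne
      -- Testing against `c` itself leaves only `g(Ic, Ic) = g(c, c)`, since `a` is orthogonal to `I
      -- • c`.
      have h0 := h c hc
      change kahlerMetric X (blockEmb e w) (blockEmb e b) _ = 0 at h0
      rw [hac, kahlerMetric_add_left, kahlerMetric_I_smul,
        kahlerMetric_I_smul_right_eq_zero X (inner_im_of_mem_realSpan he hx ha)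
          (inner_im_of_mem_realSpan he hc hx) (inner_im_of_mem_realSpan he hc ha), zero_add] at h0
      exact (kahlerMetric_pos hX hne).ne' h0
    change blockEmb e b ∈ _
    rw [hac, hc0]
    simpa using ha
  · intro hv u hu
    exact kahlerMetric_I_smul_right_eq_zero X (inner_im_of_mem_realSpan he hx hv)
      (inner_im_of_mem_realSpan he hu hx) (inner_im_of_mem_realSpan he hu hv)

end Coordinates

/-! ### Logarithmic charts and the two foliations -/

section Foliations

variable {l : ℕ} {k : Fin l → ℕ}

/-- The fiber through the line of `e`, in linear coordinates. -/
def coordFiber (X : Geom) (e : ∀ j, EuclideanSpace ℂ (Fin (k j))) : Set (Cn k) :=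
  {z | z ∈ domain k X ∧ ∃ w : Fin l → ℂ, (∀ j, w j ≠ 0) ∧ z = blockEmb e w}

/-- The leaf through `blockEmb e w` of the foliation orthogonal to the torus orbits. -/
def radialLeaf (X : Geom) (e : ∀ j, EuclideanSpace ℂ (Fin (k j))) (w : Fin l → ℂ) : Set (Cn k) :=
  {z | z ∈ domain k X ∧ ∃ ρ : Fin l → ℝ, (∀ j, 0 < ρ j) ∧ z = blockEmb e fun j => (ρ j : ℂ) * w j}

/-- The leaves of the foliation orthogonal to the torus orbits. -/
def radialLeaves (X : Geom) (e : ∀ j, EuclideanSpace ℂ (Fin (k j))) : Set (Set (Cn k)) :=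
  {L | ∃ w : Fin l → ℂ, (∀ j, w j ≠ 0) ∧ blockEmb e w ∈ domain k X ∧ L = radialLeaf X e w}

variable {e : ∀ j, EuclideanSpace ℂ (Fin (k j))}

theorem mem_orbitTk_blockEmb {w : Fin l → ℂ} (hw : ∀ j, w j ≠ 0) {z : Cn k} :
    z ∈ orbitTk (blockEmb e w) ↔
      ∃ w' : Fin l → ℂ, (∀ j, ‖w' j‖ = ‖w j‖) ∧ z = blockEmb e w' := by
  constructor
  · rintro ⟨t, ⟨s, hs⟩, rfl⟩
    refine ⟨fun j => s j * w j, fun j => by rw [norm_mul, Circle.norm_coe, one_mul], ?_⟩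
    ext a
    simp [torusAct, hs, mul_assoc]
  · rintro ⟨w', hw', rfl⟩
    have hn : ∀ j, ‖w' j / w j‖ = 1 := fun j => by
      rw [norm_div, hw', div_self (norm_ne_zero_iff.2 (hw j))]
    let s : Fin l → Circle := fun j => ⟨w' j / w j, mem_sphere_zero_iff_norm.2 (hn j)⟩
    refine ⟨fun a => s a.1, ⟨s, fun _ => rfl⟩, ?_⟩
    ext a
    change w' a.1 * e a.1 a.2 = w' a.1 / w a.1 * (w a.1 * e a.1 a.2)
    rw [← mul_assoc, div_mul_cancel₀ _ (hw a.1)]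

theorem ne_zero_of_norm_eq {w w' : Fin l → ℂ} (hw : ∀ j, w j ≠ 0) (h : ∀ j, ‖w' j‖ = ‖w j‖)
    (j : Fin l) : w' j ≠ 0 := by
  rw [← norm_ne_zero_iff, h]
  exact norm_ne_zero_iff.2 (hw j)

theorem orbitTk_eq {w w' : Fin l → ℂ} (hw : ∀ j, w j ≠ 0) (h : ∀ j, ‖w' j‖ = ‖w j‖) :
    orbitTk (blockEmb e w') = orbitTk (blockEmb e w) := by
  ext z
  rw [mem_orbitTk_blockEmb hw, mem_orbitTk_blockEmb (ne_zero_of_norm_eq hw h)]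
  simp only [h]

theorem mem_orbitTk_self {w : Fin l → ℂ} (hw : ∀ j, w j ≠ 0) :
    blockEmb e w ∈ orbitTk (blockEmb e w) :=
  (mem_orbitTk_blockEmb hw).2 ⟨w, fun _ => rfl, rfl⟩

theorem mem_radialLeaf_self {X : Geom} {w : Fin l → ℂ} (hX : blockEmb e w ∈ domain k X) :
    blockEmb e w ∈ radialLeaf X e w :=
  ⟨hX, fun _ => 1, fun _ => one_pos, by simp⟩

theorem radialLeaf_eq {X : Geom} {w : Fin l → ℂ} {ρ : Fin l → ℝ} (hρ : ∀ j, 0 < ρ j) :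
    radialLeaf X e (fun j => (ρ j : ℂ) * w j) = radialLeaf X e w := by
  ext z
  refine and_congr_right fun _ => ⟨?_, ?_⟩
  · rintro ⟨σ, hσ, rfl⟩
    refine ⟨fun j => σ j * ρ j, fun j => mul_pos (hσ j) (hρ j), ?_⟩
    simp [mul_assoc]
  · rintro ⟨σ, hσ, rfl⟩
    refine ⟨fun j => σ j / ρ j, fun j => div_pos (hσ j) (hρ j), ?_⟩
    congr 1
    ext j
    have : (ρ j : ℂ) ≠ 0 := Complex.ofReal_ne_zero.2 (hρ j).ne'
    push_cast
    field_simp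

theorem radialLeaf_subset_realSpan {X : Geom} {w : Fin l → ℂ} {z : Cn k}
    (hz : z ∈ radialLeaf X e w) : z ∈ realSpan e w := by
  obtain ⟨_, ρ, _, rfl⟩ := hz
  exact (mem_realSpan e).2 ⟨ρ, rfl⟩

theorem radialLeaf_subset {X : Geom} {w : Fin l → ℂ} (hw : ∀ j, w j ≠ 0) :
    radialLeaf X e w ⊆ coordFiber X e := by
  rintro _ ⟨hz, ρ, hρ, rfl⟩
  exact ⟨hz, _, fun j => mul_ne_zero (Complex.ofReal_ne_zero.2 (hρ j).ne') (hw j), rfl⟩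

/-- The map takes logarithms of the coordinates along the span of the `e j` and leaves the
complementary component alone. Dividing by `c` moves the base point to `1`, inside the domain of the
principal branch; the inverse is given by `c j * exp`, on the strip of imaginary parts in `(-π, π)`.
-/
theorem exists_logChart (he : ∀ j, ‖e j‖ = 1) (X : Geom) {c : Fin l → ℂ} (hc : ∀ j, c j ≠ 0)
    (hX : blockEmb e c ∈ domain k X) :
    ∃ φ : OpenPartialHomeomorph (Cn k) (Cn k), blockEmb e c ∈ φ.source ∧
      ContDiffOn ℂ ∞ φ φ.source ∧ ContDiffOn ℂ ∞ φ.symm φ.target ∧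
      (∀ y ∈ φ.source, y ∈ domain k X) ∧
      (∀ y ∈ φ.source, ∀ j, blockCoord e y j / c j ∈ Complex.slitPlane) ∧
      ∀ y, φ y = y + blockEmb e fun j => Complex.log (blockCoord e y j / c j) - blockCoord e y j := by
  let f : Cn k → Cn k := fun y =>
    y + blockEmb e fun j => Complex.log (blockCoord e y j / c j) - blockCoord e y j
  let g : Cn k → Cn k := fun y =>
    y + blockEmb e fun j => c j * Complex.exp (blockCoord e y j) - blockCoord e y j
  have hcoord : ∀ j, ContDiff ℂ ∞ fun y : Cn k => blockCoord e y j := fun j =>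
    contDiff_pi.1 (blockCoord e).contDiff j
  have hcf : ∀ y j, blockCoord e (f y) j = Complex.log (blockCoord e y j / c j) := fun y j => by
    simp only [f, map_add, blockCoord_blockEmb he]
    simp
  have hcg : ∀ y j, blockCoord e (g y) j = c j * Complex.exp (blockCoord e y j) := fun y j => by
    simp only [g, map_add, blockCoord_blockEmb he]
    simp
  have hg : ContDiff ℂ ∞ g := contDiff_id.add ((blockEmb e).contDiff.comp
    (contDiff_pi.2 fun j => (contDiff_const.mul (hcoord j).cexp).sub (hcoord j)))
  let s : Set (Cn k) := domain k X ∩ ⋂ j, {y | blockCoord e y j / c j ∈ Complex.slitPlane}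
  let t : Set (Cn k) := g ⁻¹' domain k X ∩ ⋂ j, {y | (blockCoord e y j).im ∈ Ioo (-Real.pi) Real.pi}
  have hs : ∀ y ∈ s, ∀ j, blockCoord e y j / c j ∈ Complex.slitPlane := fun y hy j =>
    mem_iInter.1 hy.2 j
  have ht : ∀ y ∈ t, ∀ j, (blockCoord e y j).im ∈ Ioo (-Real.pi) Real.pi := fun y hy j =>
    mem_iInter.1 hy.2 j
  have hlog : ∀ j, ContDiffOn ℂ ∞ (fun y => Complex.log (blockCoord e y j / c j)) s :=
    fun j y hy => (ContDiffAt.comp (g := Complex.log) y (Complex.contDiffAt_log (hs y hy j))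
      ((hcoord j).div_const (c j)).contDiffAt).contDiffWithinAt
  have hf : ContDiffOn ℂ ∞ f s := contDiffOn_id.add ((blockEmb e).contDiff.comp_contDiffOn
    (contDiffOn_pi.2 fun j => (hlog j).sub (hcoord j).contDiffOn))
  have hgf : ∀ y ∈ s, g (f y) = y := fun y hy => by
    have h : ∀ j, c j * Complex.exp (blockCoord e (f y) j) = blockCoord e y j := fun j => by
      rw [hcf, Complex.exp_log (Complex.slitPlane_ne_zero (hs y hy j)), mul_div_cancel₀ _ (hc j)]
    change f y + blockEmb e _ = y
    simp only [h]
    simp only [hcf, f]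
    rw [add_assoc, ← map_add]
    convert add_zero y
    convert map_zero (blockEmb e)
    ext j
    simp
  have hfg : ∀ y ∈ t, f (g y) = y := fun y hy => by
    have h : ∀ j, Complex.log (blockCoord e (g y) j / c j) = blockCoord e y j := fun j => by
      rw [hcg, mul_div_cancel_left₀ _ (hc j), Complex.log_exp (ht y hy j).1 (ht y hy j).2.le]
    change g y + blockEmb e _ = y
    simp only [h]
    simp only [hcg, g]
    rw [add_assoc, ← map_add]
    convert add_zero y
    convert map_zero (blockEmb e)
    ext j
    simp
  let φ : OpenPartialHomeomorph (Cn k) (Cn k) :=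
    { toFun := f
      invFun := g
      source := s
      target := t
      map_source' := fun y hy => by
        refine ⟨?_, mem_iInter.2 fun j => ?_⟩
        · rw [mem_preimage, hgf y hy]
          exact hy.1
        · rw [mem_ofPred_eq, hcf, Complex.log_im]
          exact ⟨Complex.neg_pi_lt_arg _,
            lt_of_le_of_ne (Complex.arg_le_pi _) (Complex.mem_slitPlane_iff_arg.1 (hs y hy j)).1⟩
      map_target' := fun y hy => by
        refine ⟨hy.1, mem_iInter.2 fun j => ?_⟩
        rw [mem_ofPred_eq, hcg, mul_div_cancel_left₀ _ (hc j), Complex.mem_slitPlane_iff_arg]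
        refine ⟨?_, Complex.exp_ne_zero _⟩
        rw [← Complex.log_im, Complex.log_exp (ht y hy j).1 (ht y hy j).2.le]
        exact (ht y hy j).2.ne
      left_inv' := hgf
      right_inv' := hfg
      open_source := (isOpen_domain X).inter (isOpen_iInter_of_finite fun j =>
        Complex.isOpen_slitPlane.preimage ((hcoord j).continuous.div_const (c j)))
      open_target := ((isOpen_domain X).preimage hg.continuous).inter
        (isOpen_iInter_of_finite fun j =>
          isOpen_Ioo.preimage (Complex.continuous_im.comp (hcoord j).continuous))
      continuousOn_toFun := hf.continuousOn
      continuousOn_invFun := hg.continuous.continuousOn }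
  refine ⟨φ, ⟨hX, mem_iInter.2 fun j => ?_⟩, hf, hg.contDiffOn, fun y hy => hy.1, hs, fun y => rfl⟩
  rw [mem_ofPred_eq, blockCoord_blockEmb he, div_self (hc j)]
  exact Complex.one_mem_slitPlane

/-- Charts adapted to the fiber: the fiber is straightened to its linear span, and the block
coordinates `w_j` become `log (w_j / c_j)`. -/
theorem exists_fiberChart (he : ∀ j, ‖e j‖ = 1) {X : Geom} {x : Cn k} (hx : x ∈ coordFiber X e) :
    ∃ (φ : OpenPartialHomeomorph (Cn k) (Cn k)) (c : Fin l → ℂ), (∀ j, c j ≠ 0) ∧ x ∈ φ.source ∧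
      ContDiffOn ℂ ∞ φ φ.source ∧ ContDiffOn ℂ ∞ φ.symm φ.target ∧
      (∀ y ∈ φ.source, (y ∈ coordFiber X e ↔ φ y ∈ LinearMap.range (blockEmb e).toLinearMap)) ∧
      ∀ w, φ (blockEmb e w) = blockEmb e fun j => Complex.log (w j / c j) := by
  obtain ⟨hX, c, hc, rfl⟩ := hx
  obtain ⟨φ, hφ, h₁, h₂, h₃, h₄, h₅⟩ := exists_logChart he X hc hX
  have h₆ : ∀ w, φ (blockEmb e w) = blockEmb e fun j => Complex.log (w j / c j) := fun w => by
    rw [h₅, ← map_add, blockCoord_blockEmb he]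
    congr 1
    ext j
    simp
  refine ⟨φ, c, hc, hφ, h₁, h₂, fun y hy => ⟨?_, ?_⟩, h₆⟩
  · rintro ⟨_, w, _, rfl⟩
    rw [h₆]
    exact ⟨_, rfl⟩
  · intro h
    rw [h₅] at h
    -- The chart moves each point by a vector of the range, so the point itself lies in the range.
    obtain ⟨w, rfl⟩ := ((LinearMap.range (blockEmb e).toLinearMap).add_mem_iff_left ⟨_, rfl⟩).1 h
    refine ⟨h₃ _ hy, w, fun j hj => ?_, rfl⟩
    refine Complex.slitPlane_ne_zero (h₄ _ hy j) ?_
    change blockCoord e (blockEmb e w) j / c j = 0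
    rw [blockCoord_blockEmb he, hj, zero_div]

theorem isSubmanifold_coordFiber (he : ∀ j, ‖e j‖ = 1) (X : Geom) :
    IsSubmanifold ℂ l (coordFiber X e) := by
  intro x hx
  obtain ⟨φ, c, -, hφ, h₁, h₂, h₄, -⟩ := exists_fiberChart he hx
  exact ⟨φ, _, hφ, h₁, h₂, finrank_range_blockEmb he, h₄⟩

/-- In the logarithmic chart an orbit is given by fixed real parts, so it meets the chart in at most
one slice parallel to `iℝ^l`, that is, `realSpan e fun _ => I`. -/
theorem isFoliation_orbits (he : ∀ j, ‖e j‖ = 1) (X : Geom) :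
    IsFoliation l (coordFiber X e) (orbitTk '' coordFiber X e) where
  subset := by
    rintro _ ⟨_, ⟨hX, w, hw, rfl⟩, rfl⟩ z hz
    obtain ⟨w', hw', rfl⟩ := (mem_orbitTk_blockEmb hw).1 hz
    exact ⟨mem_domain_of_norm_eq (norm_blockEmb_eq he hw') hX, w', ne_zero_of_norm_eq hw hw', rfl⟩
  existsUnique_leaf := by
    rintro _ ⟨hX, w, hw, rfl⟩
    refine ⟨_, ⟨⟨_, ⟨hX, w, hw, rfl⟩, rfl⟩, mem_orbitTk_self hw⟩, ?_⟩
    rintro _ ⟨⟨_, ⟨hX', v, hv, rfl⟩, rfl⟩, h⟩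
    obtain ⟨w', hw', h'⟩ := (mem_orbitTk_blockEmb hv).1 h
    rw [h', orbitTk_eq hv hw']
  isPathConnected := by
    rintro _ ⟨_, ⟨hX, w, hw, rfl⟩, rfl⟩
    have h : orbitTk (blockEmb e w) =
        range fun θ : Fin l → ℝ => blockEmb e fun j => Complex.exp (θ j * Complex.I) * w j := by
      ext z
      rw [mem_orbitTk_blockEmb hw]
      constructor
      · rintro ⟨w', hw', rfl⟩
        refine ⟨fun j => (w' j / w j).arg, ?_⟩
        change blockEmb e _ = _
        congr 1
        ext j
        have h := Complex.norm_mul_exp_arg_mul_I (w' j / w j)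
        rw [norm_div, hw', div_self (norm_ne_zero_iff.2 (hw j)), Complex.ofReal_one, one_mul] at h
        rw [h, div_mul_cancel₀ _ (hw j)]
      · rintro ⟨θ, rfl⟩
        exact ⟨_, fun j => by rw [norm_mul, Complex.norm_exp_ofReal_mul_I, one_mul], rfl⟩
    rw [h]
    refine isPathConnected_range ((blockEmb e).continuous.comp ?_)
    fun_prop
  chart := by
    intro x hx
    obtain ⟨φ, c, hc, hφ, h₁, h₂, h₄, h₆⟩ := exists_fiberChart he hx
    refine ⟨φ, (LinearMap.range (blockEmb e).toLinearMap).restrictScalars ℝ,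
      realSpan e fun _ => Complex.I, hφ, h₁.restrict_scalars ℝ, h₂.restrict_scalars ℝ,
      fun v hv => realSpan_le_range _ hv, finrank_realSpan he fun _ => Complex.I_ne_zero, h₄, ?_⟩
    rintro _ ⟨_, ⟨hX, v, hv, rfl⟩, rfl⟩
    refine ⟨{blockEmb e fun j => (Real.log (‖v j‖ / ‖c j‖) : ℂ)}, countable_singleton _, ?_⟩
    rintro _ hy ⟨hy', w, hw, rfl⟩
    rw [mem_orbitTk_blockEmb hv, h₆]
    simp only [mem_singleton_iff, exists_eq_left, ← map_sub, mem_realSpan]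
    constructor
    · rintro ⟨w', hw', h⟩
      obtain rfl := blockEmb_injective he h
      refine ⟨fun j => (w j / c j).arg, ?_⟩
      congr 1
      ext j
      simp [Complex.log, hw']
    · rintro ⟨ρ, h⟩
      refine ⟨w, fun j => ?_, rfl⟩
      -- The difference of logarithms is purely imaginary, hence the moduli agree.
      have h' := congrArg Complex.re (congrFun (blockEmb_injective he h) j)
      simp only [Pi.sub_apply, Complex.sub_re, Complex.log_re, Complex.ofReal_re, norm_div,
        Complex.mul_re, Complex.I_re, Complex.ofReal_im, mul_zero, zero_mul, sub_zero] at h'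
      have hw' := norm_pos_iff.2 (hw j)
      have hv' := norm_pos_iff.2 (hv j)
      have hc' := norm_pos_iff.2 (hc j)
      have := Real.log_injOn_pos (mem_Ioi.2 (div_pos hw' hc')) (mem_Ioi.2 (div_pos hv' hc'))
        (sub_eq_zero.1 h')
      exact (div_left_inj' hc'.ne').1 this

theorem convex_radialLeaf (X : Geom) (w : Fin l → ℂ) : Convex ℝ (radialLeaf X e w) := by
  rintro _ ⟨hx, ρ, hρ, rfl⟩ _ ⟨hy, σ, hσ, rfl⟩ a b ha hb hab
  refine ⟨convex_domain X hx hy ha hb hab, fun j => a * ρ j + b * σ j, fun j => ?_, ?_⟩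
  · exact convex_Ioi (0 : ℝ) (hρ j) (hσ j) ha hb hab
  · rw [← Complex.coe_smul, ← Complex.coe_smul, ← map_smul, ← map_smul, ← map_add]
    congr 1
    ext j
    simp
    ring

/-- Dual to the orbits: fixed imaginary parts of the logarithms mean fixed arguments, so the plaques
are parallel to `realSpan e fun _ => 1`. Connectedness comes from convexity. -/
theorem isFoliation_radialLeaves (he : ∀ j, ‖e j‖ = 1) (X : Geom) :
    IsFoliation l (coordFiber X e) (radialLeaves X e) where
  subset := by
    rintro _ ⟨w, hw, -, rfl⟩
    exact radialLeaf_subset hw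
  existsUnique_leaf := by
    rintro _ ⟨hX, w, hw, rfl⟩
    refine ⟨_, ⟨⟨w, hw, hX, rfl⟩, mem_radialLeaf_self hX⟩, ?_⟩
    rintro _ ⟨⟨v, hv, -, rfl⟩, -, ρ, hρ, h⟩
    rw [blockEmb_injective he h, radialLeaf_eq hρ]
  isPathConnected := by
    rintro _ ⟨w, hw, hX, rfl⟩
    exact (convex_radialLeaf X w).isPathConnected ⟨_, mem_radialLeaf_self hX⟩
  chart := by
    intro x hx
    obtain ⟨φ, c, hc, hφ, h₁, h₂, h₄, h₆⟩ := exists_fiberChart he hx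
    refine ⟨φ, (LinearMap.range (blockEmb e).toLinearMap).restrictScalars ℝ,
      realSpan e fun _ => 1, hφ, h₁.restrict_scalars ℝ, h₂.restrict_scalars ℝ,
      fun v hv => realSpan_le_range _ hv, finrank_realSpan he fun _ => one_ne_zero, h₄, ?_⟩
    rintro _ ⟨v, hv, -, rfl⟩
    refine ⟨{blockEmb e fun j => ((v j / c j).arg : ℂ) * Complex.I}, countable_singleton _, ?_⟩
    rintro _ hy ⟨hy', w, hw, rfl⟩
    simp only [h₆, mem_singleton_iff, exists_eq_left, ← map_sub, mem_realSpan]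
    constructor
    · rintro ⟨-, ρ, hρ, h⟩
      obtain rfl := blockEmb_injective he h
      refine ⟨fun j => Real.log ‖(ρ j : ℂ) * v j / c j‖, ?_⟩
      congr 1
      ext j
      have : ((ρ j : ℂ) * v j / c j).arg = (v j / c j).arg := by
        rw [mul_div_assoc, Complex.arg_real_mul _ (hρ j)]
      simp only [Pi.sub_apply, Complex.log, this]
      simp
    · rintro ⟨ρ, h⟩
      refine ⟨hy', fun j => ‖w j / c j‖ / ‖v j / c j‖, fun j => ?_, ?_⟩
      · exact div_pos (norm_pos_iff.2 (div_ne_zero (hw j) (hc j)))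
          (norm_pos_iff.2 (div_ne_zero (hv j) (hc j)))
      · congr 1
        ext j
        have h' := congrArg Complex.im (congrFun (blockEmb_injective he h) j)
        have harg : (w j / c j).arg = (v j / c j).arg := by
          simpa [Complex.log_im, sub_eq_zero] using h'
        have hv' : (‖v j / c j‖ : ℂ) ≠ 0 :=
          Complex.ofReal_ne_zero.2 (norm_ne_zero_iff.2 (div_ne_zero (hv j) (hc j)))
        -- Two nonzero numbers with equal argument differ by the positive ratio of their moduli.
        have key : w j / c j = (‖w j / c j‖ / ‖v j / c j‖ : ℂ) * (v j / c j) := by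
          calc w j / c j = ‖w j / c j‖ * Complex.exp ((w j / c j).arg * Complex.I) :=
                (Complex.norm_mul_exp_arg_mul_I _).symm
            _ = (‖w j / c j‖ / ‖v j / c j‖ : ℂ) *
                  (‖v j / c j‖ * Complex.exp ((v j / c j).arg * Complex.I)) := by
                rw [harg, ← mul_assoc, div_mul_cancel₀ _ hv']
            _ = _ := by rw [Complex.norm_mul_exp_arg_mul_I]
        rw [← mul_div_assoc, div_left_inj' (hc j)] at key
        simpa using key

end Foliations

/-! ### Tangent spaces of the fibers and of the leaves -/

section Tangent

variable {l : ℕ} {k : Fin l → ℕ} {e : ∀ j, EuclideanSpace ℂ (Fin (k j))}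

theorem contDiff_line (x v : Cn k) : ContDiff ℝ ∞ fun t : ℝ => x + t • v :=
  contDiff_const.add (contDiff_id.smul contDiff_const)

theorem eventually_line_mem_domain {X : Geom} {x : Cn k} (hx : x ∈ domain k X) (v : Cn k) :
    ∀ᶠ t in 𝓝 (0 : ℝ), x + t • v ∈ domain k X :=
  (contDiff_line x v).continuous.continuousAt.eventually_mem
    ((isOpen_domain X).mem_nhds (by simpa using hx))

theorem blockEmb_line (w b : Fin l → ℂ) (t : ℝ) :
    blockEmb e w + t • blockEmb e b = blockEmb e fun j => w j + t * b j := by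
  rw [← Complex.coe_smul, ← map_smul, ← map_add]
  rfl

/-- The fiber is open in the linear range, so short straight segments realize every direction of the
range. -/
theorem tangentVectors_coordFiber {X : Geom} {w : Fin l → ℂ} (hw : ∀ j, w j ≠ 0)
    (hX : blockEmb e w ∈ domain k X) :
    tangentVectors (coordFiber X e) (blockEmb e w) =
      LinearMap.range (blockEmb e).toLinearMap := by
  ext v
  constructor
  · rintro ⟨γ, -, -, hv, hγ⟩
    refine hv.mem_of_eventually_mem
      ((LinearMap.range (blockEmb e).toLinearMap).restrictScalars ℝ) (hγ.mono ?_)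
    rintro t ⟨-, w', -, h⟩
    rw [h]
    exact ⟨w', rfl⟩
  · rintro ⟨b, rfl⟩
    change blockEmb e b ∈ _
    refine ⟨_, contDiff_line (blockEmb e w) (blockEmb e b), by simp, hasDerivAt_line _ _, ?_⟩
    have hne : ∀ᶠ t : ℝ in 𝓝 0, ∀ j, w j + (t : ℂ) * b j ≠ 0 := by
      refine eventually_all.2 fun j => ?_
      have hc : Continuous fun t : ℝ => w j + t * b j := by fun_prop
      exact hc.continuousAt.eventually_ne (by simpa using hw j)
    filter_upwards [eventually_line_mem_domain hX (blockEmb e b), hne] with t ht ht'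
    exact ⟨ht, _, ht', blockEmb_line w b t⟩

theorem tangentVectors_radialLeaf {X : Geom} {w : Fin l → ℂ} (hX : blockEmb e w ∈ domain k X) :
    tangentVectors (radialLeaf X e w) (blockEmb e w) = realSpan e w := by
  ext v
  constructor
  · rintro ⟨γ, -, -, hv, hγ⟩
    exact hv.mem_of_eventually_mem _ (hγ.mono fun t => radialLeaf_subset_realSpan)
  · intro hv
    obtain ⟨ρ, rfl⟩ := (mem_realSpan e).1 hv
    refine ⟨_, contDiff_line (blockEmb e w) _, by simp, hasDerivAt_line _ _, ?_⟩
    have hpos : ∀ᶠ t in 𝓝 (0 : ℝ), ∀ j, 0 < 1 + t * ρ j := by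
      refine eventually_all.2 fun j => ?_
      have hc : Continuous fun t : ℝ => 1 + t * ρ j := by fun_prop
      exact hc.continuousAt.eventually_mem (Ioi_mem_nhds (by simp))
    filter_upwards [eventually_line_mem_domain hX _, hpos] with t ht ht'
    refine ⟨ht, _, ht', ?_⟩
    rw [blockEmb_line]
    congr 1
    ext j
    push_cast
    ring

/-- The squared moduli are first integrals of the orbit foliation; their derivatives detect exactly
the radial part of a velocity. -/
theorem hasDerivAt_norm_sq_blockCoord {γ : ℝ → Cn k} {v : Cn k} {t : ℝ} (h : HasDerivAt γ v t)
    (j : Fin l) : HasDerivAt (fun s => ‖blockCoord e (γ s) j‖ ^ 2)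
      (2 * ((starRingEnd ℂ) (blockCoord e (γ t) j) * blockCoord e v j).re) t := by
  have h₁ : HasDerivAt (fun s => blockCoord e (γ s)) (blockCoord e v) t :=
    ((blockCoord e).restrictScalars ℝ).hasFDerivAt.comp_hasDerivAt t h
  refine (hasDerivAt_pi.1 h₁ j).norm_sq.congr_deriv ?_
  rw [Complex.inner, mul_comm (blockCoord e v j)]

/-- Constancy of the moduli along a curve in the orbit forces `b j / w j` to be imaginary.
Conversely `exp (i t ρ j) * w j` is a curve in the orbit with the required velocity. -/
theorem tangentVectors_orbitTk (he : ∀ j, ‖e j‖ = 1) {w : Fin l → ℂ} (hw : ∀ j, w j ≠ 0)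
    {v : Cn k} : v ∈ tangentVectors (orbitTk (blockEmb e w)) (blockEmb e w) ↔
      ∃ u ∈ realSpan e w, v = Complex.I • u := by
  constructor
  · rintro ⟨γ, -, h0, hv, hγ⟩
    obtain ⟨b, rfl⟩ : v ∈ (LinearMap.range (blockEmb e).toLinearMap).restrictScalars ℝ := by
      refine hv.mem_of_eventually_mem _ (hγ.mono fun t ht => ?_)
      obtain ⟨w', -, h⟩ := (mem_orbitTk_blockEmb hw).1 ht
      rw [h]
      exact ⟨w', rfl⟩
    change HasDerivAt γ (blockEmb e b) 0 at hv
    refine ⟨_, (mem_realSpan e).2 ⟨fun j => (b j / w j).im, rfl⟩, ?_⟩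
    change blockEmb e b = _
    rw [← map_smul]
    congr 1
    ext j
    have hd := hasDerivAt_norm_sq_blockCoord (e := e) hv j
    rw [h0, blockCoord_blockEmb he, blockCoord_blockEmb he] at hd
    have hconst : (fun s => ‖blockCoord e (γ s) j‖ ^ 2) =ᶠ[𝓝 0] fun _ => ‖w j‖ ^ 2 := by
      filter_upwards [hγ] with t ht
      obtain ⟨w', hw', h⟩ := (mem_orbitTk_blockEmb hw).1 ht
      rw [h, blockCoord_blockEmb he, hw']
    have hz := hd.unique ((hasDerivAt_const (0 : ℝ) (‖w j‖ ^ 2)).congr_of_eventuallyEq hconst)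
    have hre : (b j / w j).re = 0 := by
      simp only [Complex.mul_re, Complex.conj_re, Complex.conj_im] at hz
      rw [Complex.div_re, ← add_div, div_eq_zero_iff]
      left
      linarith
    have hb : b j = (((b j / w j).re : ℂ) + (b j / w j).im * Complex.I) * w j := by
      rw [Complex.re_add_im, div_mul_cancel₀ _ (hw j)]
    refine hb.trans ?_
    simp only [hre, Pi.smul_apply, smul_eq_mul, Complex.ofReal_zero]
    ring
  · rintro ⟨_, hu, rfl⟩
    obtain ⟨ρ, rfl⟩ := (mem_realSpan e).1 hu
    have hcurve : ∀ j, ContDiff ℝ ∞ fun t : ℝ => Complex.exp (t * (ρ j * Complex.I)) * w j := by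
      intro j
      exact ((Complex.ofRealCLM.contDiff.mul contDiff_const).cexp).mul contDiff_const
    refine ⟨fun t => blockEmb e fun j => Complex.exp (t * (ρ j * Complex.I)) * w j,
      ((blockEmb e).restrictScalars ℝ).contDiff.comp (contDiff_pi.2 hcurve), by simp, ?_, ?_⟩
    · have hd : HasDerivAt (fun (t : ℝ) (j : Fin l) => Complex.exp (t * (ρ j * Complex.I)) * w j)
          (fun j => Complex.I * (ρ j * w j)) 0 := by
        refine hasDerivAt_pi.2 fun j => ?_
        have h₁ : HasDerivAt (fun t : ℝ => (t : ℂ) * (ρ j * Complex.I)) (1 * (ρ j * Complex.I)) 0 :=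
          Complex.ofRealCLM.hasDerivAt.mul_const _
        refine (h₁.cexp.mul_const (w j)).congr_deriv ?_
        simp
        ring
      refine (((blockEmb e).restrictScalars ℝ).hasFDerivAt.comp_hasDerivAt 0 hd).congr_deriv ?_
      rw [← map_smul]
      rfl
    · refine Eventually.of_forall fun t => (mem_orbitTk_blockEmb hw).2 ⟨_, fun j => ?_, rfl⟩
      rw [← mul_assoc, ← Complex.ofReal_mul, norm_mul, Complex.norm_exp_ofReal_mul_I, one_mul]

/-- The torus acts by isometries: every inner product involved is a sum of terms in `ρ j` and `‖w
j‖` alone. -/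
theorem kahlerMetric_realSpan_eq (he : ∀ j, ‖e j‖ = 1) (X : Geom) {w w' : Fin l → ℂ}
    (h : ∀ j, ‖w' j‖ = ‖w j‖) (ρ : Fin l → ℝ) :
    kahlerMetric X (blockEmb e w') (blockEmb e fun j => (ρ j : ℂ) * w' j)
        (blockEmb e fun j => (ρ j : ℂ) * w' j) =
      kahlerMetric X (blockEmb e w) (blockEmb e fun j => (ρ j : ℂ) * w j)
        (blockEmb e fun j => (ρ j : ℂ) * w j) := by
  have key : ∀ (v : Fin l → ℂ) (j : Fin l), (starRingEnd ℂ) (v j) * v j = (‖v j‖ : ℂ) ^ 2 :=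
    fun v j => Complex.conj_mul' (v j)
  have h₀ : ∀ v : Fin l → ℂ, inner ℂ (blockEmb e v) (blockEmb e v) = ∑ j, (‖v j‖ : ℂ) ^ 2 :=
    fun v => by simp only [inner_blockEmb he, key]
  have h₁ : ∀ v : Fin l → ℂ, inner ℂ (blockEmb e v) (blockEmb e fun j => (ρ j : ℂ) * v j) =
      ∑ j, (ρ j : ℂ) * (‖v j‖ : ℂ) ^ 2 := fun v => by
    simp only [inner_blockEmb he, ← key]
    exact Finset.sum_congr rfl fun j _ => by ring
  have h₂ : ∀ v : Fin l → ℂ, inner ℂ (blockEmb e fun j => (ρ j : ℂ) * v j) (blockEmb e v) =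
      ∑ j, (ρ j : ℂ) * (‖v j‖ : ℂ) ^ 2 := fun v => by
    simp only [inner_blockEmb he, ← key, map_mul, Complex.conj_ofReal]
    exact Finset.sum_congr rfl fun j _ => by ring
  simp only [kahlerMetric_eq, Geom.denom, h₀, h₁, h₂, norm_mul, h]

/-- The normal part is radial, and its coefficients `ρ j` can be read off from the derivatives of
the squared moduli, to which the orbit direction contributes nothing. -/
theorem exists_normalPart (he : ∀ j, ‖e j‖ = 1) {X : Geom} {w : Fin l → ℂ} (hw : ∀ j, w j ≠ 0)
    (hX : blockEmb e w ∈ domain k X) {u v : Cn k}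
    (hu : u ∈ LinearMap.range (blockEmb e).toLinearMap)
    (h : IsNormalPart (kahlerMetric X) (orbitTk (blockEmb e w)) (blockEmb e w) u v) :
    ∃ ρ : Fin l → ℝ, v = (blockEmb e fun j => (ρ j : ℂ) * w j) ∧
      ∀ j, ((starRingEnd ℂ) (w j) * blockCoord e u j).re = ρ j * ‖w j‖ ^ 2 := by
  obtain ⟨a, ha, hua⟩ := (tangentVectors_orbitTk he hw).1 h.1
  have hIa := (LinearMap.range (blockEmb e).toLinearMap).smul_mem Complex.I
    (realSpan_le_range w ha)
  have hv : v ∈ LinearMap.range (blockEmb e).toLinearMap := by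
    rw [← sub_sub_cancel u v, hua]
    exact Submodule.sub_mem _ hu hIa
  have hv' := (forall_kahlerMetric_I_smul_eq_zero_iff he hw hX hv).1 fun c hc =>
    h.2 _ ((tangentVectors_orbitTk he hw).2 ⟨c, hc, rfl⟩)
  obtain ⟨ρ, rfl⟩ := (mem_realSpan e).1 hv'
  obtain ⟨σ, rfl⟩ := (mem_realSpan e).1 ha
  refine ⟨ρ, rfl, fun j => ?_⟩
  rw [sub_eq_iff_eq_add.1 hua, ← map_smul, ← map_add, blockCoord_blockEmb he,
    ← Complex.normSq_eq_norm_sq, Complex.normSq_apply]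
  simp
  ring

/-- The two ends of a leafwise family have the same moduli for each `s` near `0`, so their normal
parts have the same coefficients `ρ`, and hence the same length. -/
theorem isRiemannianFoliation_orbits (he : ∀ j, ‖e j‖ = 1) (X : Geom) :
    IsRiemannianFoliation (kahlerMetric X) (orbitTk '' coordFiber X e) := by
  rintro Γ ⟨hΓ, hleaf⟩ L hL hL0 v₀ v₁ h₀ h₁
  have hd : ∀ t, HasDerivAt (fun s => Γ t s) (deriv (fun s => Γ t s) 0) 0 := fun t => by
    have : ContDiff ℝ ∞ fun s => Γ t s := hΓ.comp (contDiff_const.prodMk contDiff_id)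
    exact (this.differentiable (by simp) 0).hasDerivAt
  have hmem : ∀ᶠ s in 𝓝 (0 : ℝ), ∃ w₀ w₁ : Fin l → ℂ, (∀ j, w₀ j ≠ 0) ∧ (∀ j, ‖w₁ j‖ = ‖w₀ j‖) ∧
      blockEmb e w₀ ∈ domain k X ∧ Γ 0 s = blockEmb e w₀ ∧ Γ 1 s = blockEmb e w₁ := by
    filter_upwards [hleaf] with s hs
    obtain ⟨_, ⟨_, ⟨hX, w, hw, rfl⟩, rfl⟩, hs⟩ := hs
    obtain ⟨w₀, hw₀, h0⟩ := (mem_orbitTk_blockEmb hw).1 (hs 0 (by simp))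
    obtain ⟨w₁, hw₁, h1⟩ := (mem_orbitTk_blockEmb hw).1 (hs 1 (by simp))
    exact ⟨w₀, w₁, ne_zero_of_norm_eq hw hw₀, fun j => by rw [hw₀, hw₁],
      mem_domain_of_norm_eq (norm_blockEmb_eq he hw₀) hX, h0, h1⟩
  obtain ⟨w₀, w₁, hw₀, hw₁, hX₀, e₀, e₁⟩ := hmem.self_of_nhds
  have hX₁ := mem_domain_of_norm_eq (norm_blockEmb_eq he hw₁) hX₀
  obtain ⟨_, ⟨_, w, hw, rfl⟩, rfl⟩ := hL
  rw [e₀] at hL0 h₀ ⊢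
  rw [e₁] at h₁ ⊢
  obtain ⟨w₀', hw₀', h'⟩ := (mem_orbitTk_blockEmb hw).1 hL0
  obtain rfl := blockEmb_injective he h'
  -- The leaf is rewritten as the orbit of each endpoint, so that its tangent space there is known.
  rw [← orbitTk_eq hw hw₀'] at h₀ h₁
  rw [← orbitTk_eq hw₀ hw₁] at h₁
  have hu : ∀ t, (∀ᶠ s in 𝓝 (0 : ℝ), Γ t s ∈ LinearMap.range (blockEmb e).toLinearMap) →
      deriv (fun s => Γ t s) 0 ∈ LinearMap.range (blockEmb e).toLinearMap := fun t ht =>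
    (hd t).mem_of_eventually_mem ((LinearMap.range (blockEmb e).toLinearMap).restrictScalars ℝ) ht
  obtain ⟨ρ₀, rfl, hρ₀⟩ := exists_normalPart he hw₀ hX₀ (hu 0 (hmem.mono
    fun s ⟨a, b, _, _, _, h, _⟩ => ⟨a, h.symm⟩)) h₀
  obtain ⟨ρ₁, rfl, hρ₁⟩ := exists_normalPart he (ne_zero_of_norm_eq hw₀ hw₁) hX₁ (hu 1 (hmem.mono
    fun s ⟨a, b, _, _, _, _, h⟩ => ⟨b, h.symm⟩)) h₁
  have hρ : ρ₁ = ρ₀ := by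
    ext j
    have hd₀ := hasDerivAt_norm_sq_blockCoord (e := e) (hd 0) j
    have hd₁ := hasDerivAt_norm_sq_blockCoord (e := e) (hd 1) j
    have heq : (fun s => ‖blockCoord e (Γ 1 s) j‖ ^ 2) =ᶠ[𝓝 0]
        fun s => ‖blockCoord e (Γ 0 s) j‖ ^ 2 := by
      filter_upwards [hmem] with s hs
      obtain ⟨a, b, -, hab, -, ha, hb⟩ := hs
      rw [ha, hb, blockCoord_blockEmb he, blockCoord_blockEmb he, hab]
    have hD := hd₁.unique (hd₀.congr_of_eventuallyEq heq)
    rw [e₀, e₁, blockCoord_blockEmb he, blockCoord_blockEmb he, hρ₀, hρ₁, hw₁] at hD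
    exact mul_right_cancel₀ (pow_ne_zero 2 (norm_ne_zero_iff.2 (hw₀ j)))
      (mul_left_cancel₀ two_ne_zero hD)
  rw [hρ, kahlerMetric_realSpan_eq he X hw₁]

end Tangent

/-! ### Lagrangian leaves, geodesics and symbols -/

/-- No differentiability is needed, since the default value `0` of `deriv` also lies in `P`; this
allows iteration to second derivatives. -/
theorem deriv_mem_of_eventually_mem {E : Type*} [NormedAddCommGroup E] [NormedSpace ℝ E]
    [FiniteDimensional ℝ E] (P : Submodule ℝ E) {γ : ℝ → E} {t : ℝ}
    (hP : ∀ᶠ s in 𝓝 t, γ s ∈ P) : deriv γ t ∈ P := by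
  by_cases h : DifferentiableAt ℝ γ t
  · exact h.hasDerivAt.mem_of_eventually_mem P hP
  · rw [deriv_zero_of_not_differentiableAt h]
    exact P.zero_mem

theorem HasDerivAt.eq_zero_of_even {f : ℝ → ℝ} {d : ℝ} (h : HasDerivAt f d 0)
    (hf : ∀ t, f (-t) = f t) : d = 0 := by
  have h' : HasDerivAt (fun t => f (-t)) (-d) 0 := by
    have h₀ : HasDerivAt f d (-0) := by simpa using h
    exact (h₀.scomp (0 : ℝ) (hasDerivAt_neg (0 : ℝ))).congr_deriv (by simp)
  simp only [hf] at h'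
  linarith [h.unique h']

section Frame

variable {l : ℕ} {k : Fin l → ℕ} {e : ∀ j, EuclideanSpace ℂ (Fin (k j))}

theorem kahlerMetric_I_smul_left (X : Geom) (z u v : Cn k) :
    kahlerMetric X z (Complex.I • u) v = -kahlerMetric X z u (Complex.I • v) := by
  simp only [kahlerMetric_eq, inner_smul_left, inner_smul_right, Complex.conj_I, Complex.mul_re,
    Complex.mul_im, Complex.neg_re, Complex.neg_im, Complex.I_re, Complex.I_im]
  ring

theorem tangentVectors_radialLeaf_eq_normalVectors (he : ∀ j, ‖e j‖ = 1) {X : Geom}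
    {w : Fin l → ℂ} (hw : ∀ j, w j ≠ 0) (hX : blockEmb e w ∈ domain k X) :
    tangentVectors (radialLeaf X e w) (blockEmb e w) =
      normalVectors (kahlerMetric X) (coordFiber X e) (orbitTk (blockEmb e w))
        (blockEmb e w) := by
  ext v
  rw [tangentVectors_radialLeaf hX, normalVectors, tangentVectors_coordFiber hw hX]
  constructor
  · intro hv
    refine ⟨realSpan_le_range w hv, fun u hu => ?_⟩
    obtain ⟨a, ha, rfl⟩ := (tangentVectors_orbitTk he hw).1 hu
    exact (forall_kahlerMetric_I_smul_eq_zero_iff he hw hX (realSpan_le_range w hv)).2 hv a ha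
  · rintro ⟨hv, h⟩
    exact (forall_kahlerMetric_I_smul_eq_zero_iff he hw hX hv).1 fun u hu =>
      h _ ((tangentVectors_orbitTk he hw).2 ⟨u, hu, rfl⟩)

/-- The orbit has tangent space `iR`, and `I • v` lies in `R` exactly when `v` lies in `iR`; so the
normal space criterion is applied to `I • v`. -/
theorem isLagrangian_orbitTk (he : ∀ j, ‖e j‖ = 1) {X : Geom} {w : Fin l → ℂ}
    (hw : ∀ j, w j ≠ 0) (hX : blockEmb e w ∈ domain k X) :
    IsLagrangian (kahlerMetric X) (coordFiber X e) (orbitTk (blockEmb e w)) := by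
  intro x hx v hv
  obtain ⟨w', hw', rfl⟩ := (mem_orbitTk_blockEmb hw).1 hx
  have hX' := mem_domain_of_norm_eq (norm_blockEmb_eq he hw') hX
  rw [← orbitTk_eq hw hw']
  replace hw := ne_zero_of_norm_eq hw hw'
  replace hv : v ∈ LinearMap.range (blockEmb e).toLinearMap := by
    have := tangentVectors_coordFiber (e := e) hw hX'
    exact this.subset hv
  have key := forall_kahlerMetric_I_smul_eq_zero_iff he hw hX'
    (Submodule.smul_mem _ Complex.I hv)
  refine (tangentVectors_orbitTk he hw).trans ⟨?_, ?_⟩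
  · rintro ⟨a, ha, rfl⟩ u hu
    obtain ⟨c, hc, rfl⟩ := (tangentVectors_orbitTk he hw).1 hu
    refine key.2 ?_ c hc
    rw [smul_smul, Complex.I_mul_I, neg_one_smul]
    exact Submodule.neg_mem _ ha
  · intro h
    refine ⟨-(Complex.I • v), Submodule.neg_mem _ (key.1 fun u hu =>
      h _ ((tangentVectors_orbitTk he hw).2 ⟨u, hu, rfl⟩)), ?_⟩
    rw [smul_neg, smul_smul, Complex.I_mul_I, neg_one_smul, neg_neg]

theorem isLagrangian_radialLeaf (he : ∀ j, ‖e j‖ = 1) {X : Geom} {w : Fin l → ℂ}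
    (hw : ∀ j, w j ≠ 0) :
    IsLagrangian (kahlerMetric X) (coordFiber X e) (radialLeaf X e w) := by
  rintro _ ⟨hX, ρ, hρ, rfl⟩ v hv
  rw [← radialLeaf_eq hρ]
  replace hw : ∀ j, (ρ j : ℂ) * w j ≠ 0 := fun j =>
    mul_ne_zero (Complex.ofReal_ne_zero.2 (hρ j).ne') (hw j)
  replace hv := (tangentVectors_coordFiber (e := e) hw hX).subset hv
  have hT := tangentVectors_radialLeaf (e := e) hX
  have key := forall_kahlerMetric_I_smul_eq_zero_iff he hw hX hv
  refine (Set.ext_iff.1 hT v).trans (key.symm.trans ?_)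
  refine forall_congr' fun u => ?_
  -- Moving `I` across the metric costs only a sign and turns the condition into the normal space
  -- criterion for `v`.
  rw [fundamentalForm, kahlerMetric_I_smul_left, neg_eq_zero]
  exact imp_congr_left (Set.ext_iff.1 hT u).symm

theorem covariantAcceleration_add {X : Geom} {γ : ℝ → Cn k} {t : ℝ} (ht : γ t ∈ domain k X)
    (u v : Cn k) : covariantAcceleration (kahlerMetric X) γ t (u + v) =
      covariantAcceleration (kahlerMetric X) γ t u +
        covariantAcceleration (kahlerMetric X) γ t v := by
  have h : fderiv ℝ (fun x => kahlerMetric X x (deriv γ t) (u + v)) (γ t) =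
      fderiv ℝ (fun x => kahlerMetric X x (deriv γ t) u) (γ t) +
        fderiv ℝ (fun x => kahlerMetric X x (deriv γ t) v) (γ t) := by
    simp only [kahlerMetric_add_right]
    exact fderiv_fun_add (differentiableAt_kahlerMetric ht _ _)
      (differentiableAt_kahlerMetric ht _ _)
  rw [covariantAcceleration, kahlerMetric_add_right, h, map_add, add_apply,
    covariantAcceleration, covariantAcceleration]
  ring

/-- The metric is even in the direction `i u` at a point of a totally real subspace. -/
theorem kahlerMetric_line_even (he : ∀ j, ‖e j‖ = 1) (X : Geom) {w : Fin l → ℂ} {x u v : Cn k}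
    (hx : x ∈ realSpan e w) (hu : u ∈ realSpan e w) (hv : v ∈ realSpan e w) (t : ℝ) :
    kahlerMetric X (x + (-t) • (Complex.I • u)) v v =
      kahlerMetric X (x + t • (Complex.I • u)) v v := by
  have hxu := inner_im_of_mem_realSpan he hx hu
  have hux := inner_im_of_mem_realSpan he hu hx
  have hxv := inner_im_of_mem_realSpan he hx hv
  have hvx := inner_im_of_mem_realSpan he hv hx
  have huv := inner_im_of_mem_realSpan he hu hv
  have hvu := inner_im_of_mem_realSpan he hv hu
  have huu := inner_im_of_mem_realSpan he hu hu
  simp only [← Complex.coe_smul, kahlerMetric_eq, Geom.denom, inner_add_left, inner_add_right,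
    inner_smul_left, inner_smul_right, Complex.conj_I, Complex.conj_ofReal, Complex.add_re,
    Complex.add_im, Complex.mul_re, Complex.mul_im, Complex.neg_re, Complex.neg_im, Complex.I_re,
    Complex.I_im, Complex.ofReal_re, Complex.ofReal_im, hxu, hux, hxv, hvx, huv, hvu, huu]
  ring

/-- The three terms vanish separately: the acceleration stays in the real span, orthogonal to `I •
u`; the pairing of the velocity with `I • u` is identically zero along the real span; and `g(γ',
γ')` is even in the direction `I • u`. -/
theorem covariantAcceleration_I_smul_eq_zero (he : ∀ j, ‖e j‖ = 1) {X : Geom} {w : Fin l → ℂ}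
    {γ : ℝ → Cn k} {t : ℝ} (hX : γ t ∈ domain k X) (hγ : ∀ᶠ s in 𝓝 t, γ s ∈ realSpan e w)
    {u : Cn k} (hu : u ∈ realSpan e w) :
    covariantAcceleration (kahlerMetric X) γ t (Complex.I • u) = 0 := by
  have hx := hγ.self_of_nhds
  have hv := deriv_mem_of_eventually_mem _ hγ
  have ha : deriv (deriv γ) t ∈ realSpan e w := deriv_mem_of_eventually_mem _
    (hγ.eventually_nhds.mono fun s hs => deriv_mem_of_eventually_mem _ hs)
  have orth : ∀ {y a b : Cn k}, y ∈ realSpan e w → a ∈ realSpan e w → b ∈ realSpan e w →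
      kahlerMetric X y a (Complex.I • b) = 0 := fun hy ha hb =>
    kahlerMetric_I_smul_right_eq_zero X (inner_im_of_mem_realSpan he hy ha)
      (inner_im_of_mem_realSpan he hb hy) (inner_im_of_mem_realSpan he hb ha)
  have h₁ : fderiv ℝ (fun x => kahlerMetric X x (deriv γ t) (Complex.I • u)) (γ t)
      (deriv γ t) = 0 := by
    have h := hasDerivAt_kahlerMetric_line hX (deriv γ t) (deriv γ t) (Complex.I • u)
    have hz : ∀ s : ℝ, kahlerMetric X (γ t + s • deriv γ t) (deriv γ t) (Complex.I • u) = 0 :=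
      fun s => orth (Submodule.add_mem _ hx (Submodule.smul_mem _ s hv)) hv hu
    simp only [hz] at h
    exact h.unique (hasDerivAt_const _ _)
  have h₂ : fderiv ℝ (fun x => kahlerMetric X x (deriv γ t) (deriv γ t)) (γ t)
      (Complex.I • u) = 0 :=
    (hasDerivAt_kahlerMetric_line hX (Complex.I • u) (deriv γ t) (deriv γ t)).eq_zero_of_even
      (kahlerMetric_line_even he X hx hu hv)
  rw [covariantAcceleration, h₁, h₂, orth hx ha hu]
  ring

/-- A tangent vector of the fiber is `u₁ + I • u₂` with both parts in the real span. The geodesic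
equation of the leaf handles `u₁`, and the reflection symmetry handles `I • u₂`. -/
theorem isTotallyGeodesic_radialLeaf (he : ∀ j, ‖e j‖ = 1) {X : Geom} {w : Fin l → ℂ}
    (hw : ∀ j, w j ≠ 0) :
    IsTotallyGeodesic (kahlerMetric X) (coordFiber X e) (radialLeaf X e w) := by
  rintro a b γ ⟨hγ, hmem, hacc⟩
  refine ⟨hγ, fun t ht => radialLeaf_subset hw (hmem t ht), fun t ht v hv => ?_⟩
  obtain ⟨hX, ρ, hρ, hx⟩ := hmem t ht
  have hw' : ∀ j, (ρ j : ℂ) * w j ≠ 0 := fun j =>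
    mul_ne_zero (Complex.ofReal_ne_zero.2 (hρ j).ne') (hw j)
  -- The leaf is based anew at the current point `γ t`, where its tangent space is the real span of
  -- that point.
  have hL := radialLeaf_eq (X := X) (e := e) (w := w) hρ
  have hX' := hX
  rw [hx] at hX'
  have hev : ∀ᶠ s in 𝓝 t, γ s ∈ realSpan e fun j => (ρ j : ℂ) * w j := by
    filter_upwards [isOpen_Ioo.mem_nhds ht] with s hs
    exact radialLeaf_subset_realSpan (hL ▸ hmem s hs)
  rw [hx] at hv
  obtain ⟨c, rfl⟩ := (tangentVectors_coordFiber (e := e) hw' hX').subset hv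
  obtain ⟨u₁, hu₁, u₂, hu₂, hc⟩ := exists_add_I_smul (e := e) hw' c
  change covariantAcceleration _ γ t (blockEmb e c) = 0
  rw [hc, covariantAcceleration_add hX, covariantAcceleration_I_smul_eq_zero he hX hev hu₂,
    add_zero]
  refine hacc t ht u₁ ?_
  rw [hx, ← hL]
  exact (tangentVectors_radialLeaf (e := e) hX').superset hu₁

theorem isLagrangianFrame_orbits_radialLeaves (he : ∀ j, ‖e j‖ = 1) (X : Geom) :
    (∀ L ∈ orbitTk '' coordFiber X e, ∀ L' ∈ radialLeaves X e, ∀ x ∈ L ∩ L',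
      tangentVectors L' x = normalVectors (kahlerMetric X) (coordFiber X e) L x) ∧
    IsLagrangianFrame (kahlerMetric X) l (coordFiber X e) (orbitTk '' coordFiber X e)
      (radialLeaves X e) := by
  have hnormal : ∀ L ∈ orbitTk '' coordFiber X e, ∀ L' ∈ radialLeaves X e, ∀ x ∈ L ∩ L',
      tangentVectors L' x = normalVectors (kahlerMetric X) (coordFiber X e) L x := by
    rintro _ ⟨_, ⟨hX₀, w₀, hw₀, rfl⟩, rfl⟩ _ ⟨w, hw, -, rfl⟩ x ⟨hx₀, hX, ρ, hρ, rfl⟩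
    obtain ⟨w', hw', h⟩ := (mem_orbitTk_blockEmb hw₀).1 hx₀
    obtain rfl := blockEmb_injective he h
    rw [← orbitTk_eq hw₀ hw', ← radialLeaf_eq hρ]
    exact tangentVectors_radialLeaf_eq_normalVectors he (ne_zero_of_norm_eq hw₀ hw') hX
  refine ⟨hnormal, isFoliation_orbits he X, isFoliation_radialLeaves he X, ?_, ?_, ?_,
    isRiemannianFoliation_orbits he X, ?_⟩
  · rintro _ ⟨_, ⟨hX, w, hw, rfl⟩, rfl⟩
    exact isLagrangian_orbitTk he hw hX
  · rintro _ ⟨w, hw, -, rfl⟩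
    exact isLagrangian_radialLeaf he hw
  · intro L₁ h₁ L₂ h₂ x hx v hv u hu
    rw [kahlerMetric_symm]
    exact ((hnormal L₁ h₁ L₂ h₂ x hx).subset hu).2 v hv
  · rintro _ ⟨w, hw, -, rfl⟩
    exact isTotallyGeodesic_radialLeaf he hw

theorem symbol_eq_of_mem_orbitTk {X : Geom} {h : Fin l → ℕ} {f : ↥(Vk k ∩ domain k X) → ℂ}
    (hf : f ∈ symbols X k h) {x : Cn k} {z w : ↥(Vk k ∩ domain k X)} (hz : z.1 ∈ orbitTk x)
    (hw : w.1 ∈ orbitTk x) : f z = f w := by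
  obtain ⟨a, p, q, -, hpq, -, -, hf⟩ := hf
  have key : ∀ y ∈ orbitTk x, a (fun j => ‖block y j‖) *
      ((∏ b, (y b / ‖block y b.1‖) ^ p b) *
        ∏ b, (starRingEnd ℂ) (y b / ‖block y b.1‖) ^ q b) =
      a (fun j => ‖block x j‖) * ((∏ b, (x b / ‖block x b.1‖) ^ p b) *
        ∏ b, (starRingEnd ℂ) (x b / ‖block x b.1‖) ^ q b) := by
    rintro _ ⟨t, ⟨s, hs⟩, rfl⟩
    have hblock : ∀ j, ‖block (torusAct t x) j‖ = ‖block x j‖ := fun j => by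
      have : block (torusAct t x) j = (s j : ℂ) • block x j := by
        ext i
        simp [block, torusAct, hs]
      rw [this, norm_smul, Circle.norm_coe, one_mul]
    have hcoord : ∀ b, torusAct t x b = s b.1 * x b := fun b => by simp [torusAct, hs]
    -- Within block `j` the total phase is `s j` to the power `∑ p` times its conjugate to the power
    -- `∑ q`; equal degrees make this a power of `‖s j‖ ^ 2 = 1`.
    have hphase : (∏ b : Σ j : Fin l, Fin (k j), (s b.1 : ℂ) ^ p b) *
        ∏ b : Σ j : Fin l, Fin (k j), (starRingEnd ℂ) (s b.1 : ℂ) ^ q b = 1 := by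
      rw [Fintype.prod_sigma, Fintype.prod_sigma, ← Finset.prod_mul_distrib]
      refine Finset.prod_eq_one fun j _ => ?_
      dsimp only
      rw [Finset.prod_pow_eq_pow_sum, Finset.prod_pow_eq_pow_sum, hpq, ← mul_pow,
        Complex.mul_conj', Circle.norm_coe]
      simp
    simp only [hblock, hcoord, mul_div_assoc, map_mul, mul_pow, Finset.prod_mul_distrib]
    rw [mul_mul_mul_comm, hphase, one_mul]
  rw [hf, hf, key _ hz, key _ hw]

end Frame

theorem mainTheorem7 {l : ℕ} (k : Fin l → ℕ) (hk : ∀ j, 0 < k j) (h : Fin l → ℕ) (X : Geom)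
    (p : ∀ j, ℙ ℂ (EuclideanSpace ℂ (Fin (k j)))) :
    IsKahlerSubmanifold (kahlerMetric X) (domain k X) l (fiber X p) ∧
    (IsFoliation l (fiber X p) (orbitLeaves X p) ∧
      IsRiemannianFoliation (kahlerMetric X) (orbitLeaves X p) ∧
      ∀ f ∈ symbols X k h, ∀ L ∈ orbitLeaves X p, ∀ z w : ↥(Vk k ∩ domain k X),
        z.1 ∈ L → w.1 ∈ L → f z = f w) ∧
    ∃ 𝓕 : Set (Set (Cn k)),
      (IsFoliation l (fiber X p) 𝓕 ∧
        (∀ L ∈ orbitLeaves X p, ∀ L' ∈ 𝓕, ∀ x ∈ L ∩ L',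
          tangentVectors L' x = normalVectors (kahlerMetric X) (fiber X p) L x) ∧
        ∀ L' ∈ 𝓕, IsTotallyGeodesic (kahlerMetric X) (fiber X p) L') ∧
      IsLagrangianFrame (kahlerMetric X) l (fiber X p) (orbitLeaves X p) 𝓕 := by
  -- Normalized representatives of the lines make `blockEmb e` isometric.
  let e : ∀ j, EuclideanSpace ℂ (Fin (k j)) := fun j => ((‖(p j).rep‖⁻¹ : ℝ) : ℂ) • (p j).rep
  have hrep : ∀ j, ‖(p j).rep‖ ≠ 0 := fun j => norm_ne_zero_iff.2 (p j).rep_nonzero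
  have hc : ∀ j, ((‖(p j).rep‖⁻¹ : ℝ) : ℂ) ≠ 0 := fun j =>
    Complex.ofReal_ne_zero.2 (inv_ne_zero (hrep j))
  have he : ∀ j, ‖e j‖ = 1 := fun j => by
    simp only [e, norm_smul, Complex.norm_real, norm_inv, norm_norm]
    exact inv_mul_cancel₀ (hrep j)
  have he₀ : ∀ j, e j ≠ 0 := fun j => smul_ne_zero (hc j) (p j).rep_nonzero
  have hp : ∀ j, p j = Projectivization.mk ℂ (e j) (he₀ j) := fun j => by
    rw [← (p j).mk_rep, eq_comm, projectivization_mk_eq_iff]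
    exact ⟨_, hc j, rfl⟩
  have hF : fiber X p = coordFiber X e := by
    ext z
    exact mem_fiber_iff he₀ hp
  obtain ⟨hnormal, hframe⟩ := isLagrangianFrame_orbits_radialLeaves he X
  rw [orbitLeaves, hF]
  refine ⟨⟨isKahlerMetric_kahlerMetric X, fun z hz => hz.1, isSubmanifold_coordFiber he X⟩,
    ⟨hframe.foliation_fst, hframe.riemannian, ?_⟩, radialLeaves X e,
    ⟨hframe.foliation_snd, hnormal, hframe.totallyGeodesic⟩, hframe⟩
  rintro f hf _ ⟨x, -, rfl⟩ z w hz hw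
  exact symbol_eq_of_mem_orbitTk hf hz hw
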